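/- Fix $\lambda\in(0,1)$. For a strictly increasing sequence $p_1<p_2<\cdots$ of mutually coprime positive integers let $X_n:=\{0,1,\dots,p_n-1\}$, let $T_n x:=x+1 \pmod{p_n}$, and let $\mu_n$ be the probability measure on $X_n$ that is constant on $\{j\le p_n/2\}$ and constant on $\{j>p_n/2\}$, the second value being $\lambda$ times the first. Put $P_n:=p_1\cdots p_{n-1}$ (so $P_1=1$) and $$Y_n:=\{x\in X_n: x<\tfrac{p_n}2-P_n\}\cup\{x\in X_n:\tfrac{p_n}2<x<p_n-P_n\},\qquad Z_n:=\{x\in X_n: P_n<x<\tfrac{p_n}2\}.$$ For equivalent probability measures let $H^2(\gamma,\delta):=\frac12\int\big(1-\sqrt{d\gamma/d\delta}\,\big)^2d\delta$. Call $(p_n)$ *fast* if - $\sum_{n\ge1} H^2(\mu_n,\mu_n\circ T_n^{-1})<\infty$, - $\mu_n(Y_n)>1-2^{-n-1}$ for all $n\ge1$, - $\mu_n(Z_n)>\frac1{2(\lambda+1)}$ for all $n\ge1$. Every strictly increasing sequence of mutually coprime positive integers has a fast subsequence. If $(p_n)$ is such a sequence and is fast, then the system $(X,\mu,T):=\bigotimes_{n\ge1}(X_n,\mu_n,T_n)$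 has the following properties. 1. It is IDPFT: $T$ is $\mu$-nonsingular (i.e. $\mu\circ T^{-1}\sim\mu$), and each $T_n$ is nonsingular and has an invariant probability measure equivalent to $\mu_n$. 2. It is rigid: there are $n_k\to\infty$ such that $\mu(T^{-n_k}A\,\triangle\,A)\to0$ for every measurable $A$ and $\frac{d\mu\circ T^{n_k}}{d\mu}\to1$ in $L^1(\mu)$. 3. It is ergodic of Krieger's type $III_\lambda$: $T$ is $\mu$-ergodic, and the set of essential values of its Radon–Nikodym cocycle is exactly $\{n\log\lambda: n\in\mathbb Z\}$. Here $g\in\mathbb R$ is an essential value if for every measurable $A$ with $\mu(A)>0$ and every neighbourhood $U$ of $g$ there are a measurable $B\subset A$ with $\mu(B)>0$ and $k\in\mathbb Z$ such that $T^kB\subset A$ and $\log\frac{d\mu\circ T^k}{d\mu}(x)\in U$ for all $x\in B$. -/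

import Mathlib

open MeasureTheory Filter Topology

noncomputable section

namespace RigidIDPFT

section General

variable {Y : Type*} [MeasurableSpace Y]

/-- `γ ∈ Aut(Y, μ)`: an invertible bimeasurable transformation with `μ ∘ γ⁻¹ ∼ μ`. -/
def IsNonsingular (μ : Measure Y) (γ : Equiv.Perm Y) : Prop :=
  Measurable γ ∧ Measurable γ.symm ∧ μ.map γ ≪ μ ∧ μ ≪ μ.map γ

/-- The Radon-Nikodym derivative `d(μ ∘ γ)/dμ`, where `(μ ∘ γ)(A) = μ(γ A)`, that is,
`μ ∘ γ` is the push-forward of `μ` under `γ⁻¹`. -/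
def rnRatio (μ : Measure Y) (γ : Equiv.Perm Y) (y : Y) : ℝ :=
  ((μ.map γ.symm).rnDeriv μ y).toReal

/-- The logarithm of the Radon-Nikodym cocycle, `ρ_μ(γ, y) = log (d(μ ∘ γ)/dμ)(y)`. -/
def logRN (μ : Measure Y) (γ : Equiv.Perm Y) (y : Y) : ℝ :=
  Real.log (rnRatio μ γ y)

/-- `Γ` is an ergodic countable group of nonsingular transformations of `(Y, μ)`. -/
structure IsErgodicGroup (μ : Measure Y) (Γ : Subgroup (Equiv.Perm Y)) : Prop where
  countable : Countable Γ
  nonsingular : ∀ γ ∈ Γ, IsNonsingular μ γ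
  trivial_of_invariant : ∀ A : Set Y, MeasurableSet A →
    (∀ γ ∈ Γ, γ ⁻¹' A =ᵐ[μ] A) → μ A = 0 ∨ μ Aᶜ = 0

/-- `g` is an essential value of the logarithm of the Radon-Nikodym cocycle of `Γ`. -/
def IsEssentialValue (μ : Measure Y) (Γ : Subgroup (Equiv.Perm Y)) (g : ℝ) : Prop :=
  ∀ A : Set Y, MeasurableSet A → 0 < μ A → ∀ U ∈ 𝓝 g,
    ∃ B : Set Y, B ⊆ A ∧ MeasurableSet B ∧ 0 < μ B ∧
      ∃ γ ∈ Γ, γ '' B ⊆ A ∧ ∀ y ∈ B, logRN μ γ y ∈ U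

/-- `Γ` is ergodic of Krieger's type `III_lam`, `0 < lam < 1`: the set of essential values of
its Radon-Nikodym cocycle is `{n log lam | n ∈ ℤ}`. -/
def IsKriegerTypeIII (lam : ℝ) (μ : Measure Y) (Γ : Subgroup (Equiv.Perm Y)) : Prop :=
  0 < lam ∧ lam < 1 ∧ IsErgodicGroup μ Γ ∧
    {g : ℝ | IsEssentialValue μ Γ g} = Set.range fun n : ℤ => (n : ℝ) * Real.log lam

/-- A nonsingular transformation `T` of a probability space is rigid if `T ^ n_k → I` weakly in
`Aut(Y, μ)` along some sequence `n_k → ∞`: all measurable sets are asymptotically fixed, and the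
Radon-Nikodym derivatives of the powers `T ^ n_k` converge to `1` in `L¹(μ)`. -/
def IsRigid (μ : Measure Y) (T : Equiv.Perm Y) : Prop :=
  ∃ s : ℕ → ℕ, StrictMono s ∧
    (∀ A : Set Y, MeasurableSet A →
      Tendsto (fun k => μ (symmDiff ((T ^ s k) ⁻¹' A) A)) atTop (𝓝 0)) ∧
    Tendsto (fun k => ∫ y, |rnRatio μ (T ^ s k) y - 1| ∂μ) atTop (𝓝 0)

/-- `T` is of finite type: it is nonsingular and has an invariant probability measure that is
equivalent to `μ`. -/
def IsFiniteType (μ : Measure Y) (T : Equiv.Perm Y) : Prop :=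
  IsNonsingular μ T ∧
    ∃ ν : Measure Y, IsProbabilityMeasure ν ∧ ν ≪ μ ∧ μ ≪ ν ∧ ν.map T = ν

/-- The squared Hellinger distance of two equivalent probability measures. -/
def hellingerSq (γ δ : Measure Y) : ℝ :=
  (1 / 2) * ∫ y, (1 - Real.sqrt (γ.rnDeriv δ y).toReal) ^ 2 ∂δ

/-- `(X, μ, T) = ⨂ (X_n, μ_n, T_n)` is IDPFT (an infinite direct product of finite types):
the product transformation is nonsingular and every factor is of finite type. -/
def IsIDPFT {X : ℕ → Type*} [∀ n, MeasurableSpace (X n)]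
    (μ : ∀ n, Measure (X n)) (T : ∀ n, Equiv.Perm (X n)) : Prop :=
  (∀ n, IsProbabilityMeasure (μ n)) ∧ (∀ n, IsFiniteType (μ n) (T n)) ∧
    IsNonsingular (Measure.infinitePi μ) (Equiv.piCongrRight T)

end General

/-- The weight `1` on `{j | j ≤ p / 2}` and `lam` on `{j | j > p / 2}`. -/
def levelWeight (lam : ℝ) (p : ℕ) (j : Fin p) : ℝ :=
  if (j : ℝ) ≤ (p : ℝ) / 2 then 1 else lam

/-- The two-level probability measure on `{0, …, p - 1}`: constant on `{j ≤ p / 2}`, constant on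
`{j > p / 2}`, the second value being `lam` times the first. -/
def levelMeasure (lam : ℝ) (p : ℕ) : Measure (Fin p) :=
  ∑ j : Fin p,
    ENNReal.ofReal (levelWeight lam p j / ∑ i : Fin p, levelWeight lam p i) • Measure.dirac j

/-- The product `p_0 ⋯ p_{n-1}` (`1` for `n = 0`; sequences are indexed from `0`). -/
def partialProd (p : ℕ → ℕ) (n : ℕ) : ℕ := ∏ k ∈ Finset.range n, p k

/-- The set `Y_n`. -/
def setY (p : ℕ → ℕ) (n : ℕ) : Set (Fin (p n)) :=
  {x | (x : ℝ) < (p n : ℝ) / 2 - partialProd p n} ∪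
    {x | (p n : ℝ) / 2 < (x : ℝ) ∧ (x : ℝ) < (p n : ℝ) - partialProd p n}

/-- The set `Z_n`. -/
def setZ (p : ℕ → ℕ) (n : ℕ) : Set (Fin (p n)) :=
  {x | (partialProd p n : ℝ) < (x : ℝ) ∧ (x : ℝ) < (p n : ℝ) / 2}

/-- A strictly increasing sequence of mutually coprime positive integers. -/
structure IsCoprimeSeq (p : ℕ → ℕ) : Prop where
  pos : ∀ n, 0 < p n
  strictMono : StrictMono p
  coprime : Pairwise fun i j => Nat.Coprime (p i) (p j)

/-- The three growth conditions on `p` (with indices shifted, since sequences start at `0`). -/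
structure IsFast (lam : ℝ) (p : ℕ → ℕ) : Prop where
  summable_hellinger : Summable fun n =>
    hellingerSq (levelMeasure lam (p n)) ((levelMeasure lam (p n)).map (finRotate (p n)))
  measure_setY : ∀ n, 1 - (1 / 2 : ℝ) ^ (n + 2) < (levelMeasure lam (p n)).real (setY p n)
  measure_setZ : ∀ n, 1 / (2 * (lam + 1)) < (levelMeasure lam (p n)).real (setZ p n)

/-- The product measure `μ = ⨂ μ_n` on `X = ∏ {0, …, p_n - 1}`. -/
def prodMeasure (lam : ℝ) (p : ℕ → ℕ) : Measure (∀ n, Fin (p n)) :=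
  Measure.infinitePi fun n => levelMeasure lam (p n)

/-- The product `T` of the cyclic rotations `x ↦ x + 1 (mod p_n)`. -/
def prodRotation (p : ℕ → ℕ) : Equiv.Perm (∀ n, Fin (p n)) :=
  Equiv.piCongrRight fun n => finRotate (p n)

end RigidIDPFT

end

/-! Everything rests on exact scaling. A power `T^j` acts coordinatewise, and in coordinate `n` it
changes the mass of a point only if it moves that point across levels. If `0 ≤ j ≤ P_n`, points of
`Y_n` stay on their level, and the complement of `Y_n` has mass below `2^{-n-2}`. By Borel–Cantelli
almost every point changes level in only finitely many coordinates. Up to a null set the space is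
therefore a countable union of pieces (a cylinder with a tail condition) on which `T^j` multiplies
the measure by a constant power of `lam` (`scalesOn_cyl_inter`). This gives nonsingularity and
confines the cocycle to the lattice `ℤ log lam`.

Rigidity: `T^{P_k}` fixes the first `k` coordinates and preserves measure on the set where all later
coordinates lie in `Y_n`, which has mass at least `1 - 2^{-k-1}`.

Ergodicity: by the Chinese remainder theorem some `T^j` with `j < P_k` carries one depth-`k`
cylinder onto another in the first `k` coordinates, with constant scaling off a fraction `2^{-k-1}`.
An invariant set thus has nearly the same density in all depth-`k` cylinders, and in the limit `μ A
≤ (μ A)^2`.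

The value `log lam`: choose `j ≡ 0` mod `p_n` for `n < k` and `j ≡ ⌊p_k/2⌋` mod `p_k`. On points
with `k`-th coordinate in `Z_k` and later ones in `Y_n`, `T^j` scales by exactly `lam` and stays in
the depth-`k` cylinder. These points fill at least an eighth of it, so a cylinder almost filled by
`A` supplies the required subset.

A fast subsequence exists because each condition fails on at most about `P_n` points, a negligible
share once `p_n` is large compared with `2^n P_n`. -/

noncomputable section

open scoped ENNReal NNReal

namespace RigidIDPFT

/-! ### Exact scaling of a measure and essential values -/

section Scaling

variable {Y : Type*} [MeasurableSpace Y] {μ : Measure Y} {γ γ' : Equiv.Perm Y} {c c' : ℝ≥0}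
  {A B : Set Y}

/-- `γ` multiplies the `μ`-measure of measurable subsets of `B` by `c`. -/
def ScalesOn (μ : Measure Y) (γ : Equiv.Perm Y) (c : ℝ≥0) (B : Set Y) : Prop :=
  ∀ S ⊆ B, MeasurableSet S → μ (γ '' S) = c * μ S

lemma measurableSet_image_perm (hγ : Measurable γ.symm) (hA : MeasurableSet A) :
    MeasurableSet (γ '' A) := by
  rw [Equiv.image_eq_preimage_symm]
  exact hγ hA

lemma ScalesOn.mono (h : ScalesOn μ γ c B) (hAB : A ⊆ B) : ScalesOn μ γ c A :=
  fun S hS hm => h S (hS.trans hAB) hm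

lemma ScalesOn.trans (hγ : Measurable γ.symm) (h : ScalesOn μ γ c B)
    (h' : ScalesOn μ γ' c' (γ '' B)) : ScalesOn μ (γ' * γ) (c' * c) B := by
  intro S hS hm
  have : (γ' * γ) '' S = γ' '' (γ '' S) := by
    rw [Set.image_image]; rfl
  rw [this, h' _ (Set.image_mono hS) (measurableSet_image_perm hγ hm), h S hS hm]
  push_cast
  ring

lemma ScalesOn.inv (hγ : Measurable γ) (hc : c ≠ 0) (h : ScalesOn μ γ c B) :
    ScalesOn μ γ⁻¹ c⁻¹ (γ '' B) := by
  intro S hS hm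
  have h1 : ⇑γ⁻¹ '' S = γ ⁻¹' S := by
    rw [Equiv.Perm.inv_def, Equiv.image_symm_eq_preimage]
  have h2 : γ ⁻¹' S ⊆ B := by
    intro x hx
    obtain ⟨y, hy, hxy⟩ := hS hx
    rwa [γ.injective hxy] at hy
  have h3 := h _ h2 (hγ hm)
  rw [Set.image_preimage_eq _ γ.surjective] at h3
  rw [h1, h3, ← mul_assoc, ← ENNReal.coe_mul, inv_mul_cancel₀ hc, ENNReal.coe_one, one_mul]

lemma ScalesOn.restrict_eq (hγ : Measurable γ.symm) (hB : MeasurableSet B)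
    (h : ScalesOn μ γ c B) : (μ.map γ.symm).restrict B = c • μ.restrict B := by
  ext S hS
  rw [Measure.restrict_apply hS, Measure.map_apply hγ (hS.inter hB),
    ← Equiv.image_eq_preimage_symm, h _ Set.inter_subset_right (hS.inter hB),
    Measure.smul_apply, Measure.restrict_apply hS, ENNReal.smul_def, smul_eq_mul]

lemma scalesOn_of_restrict_eq (hγ : Measurable γ.symm)
    (h : (μ.map γ.symm).restrict B = c • μ.restrict B) : ScalesOn μ γ c B := by
  intro S hS hm
  have := congrArg (fun m => m S) h
  simp only [Measure.smul_apply, Measure.restrict_apply hm,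
    Set.inter_eq_self_of_subset_left hS, Measure.map_apply hγ hm] at this
  rw [Equiv.image_eq_preimage_symm, this, ENNReal.smul_def, smul_eq_mul]

lemma restrict_map_symm_eq_of_singleton [Countable Y] [MeasurableSingletonClass Y]
    (h : ∀ x ∈ B, μ {γ x} = c * μ {x}) : (μ.map γ.symm).restrict B = c • μ.restrict B := by
  refine Measure.ext_of_singleton fun x => ?_
  rw [Measure.smul_apply, Measure.restrict_apply (measurableSet_singleton x),
    Measure.restrict_apply (measurableSet_singleton x), ENNReal.smul_def, smul_eq_mul]
  by_cases hx : x ∈ B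
  · rw [Set.inter_eq_self_of_subset_left (by simpa using hx),
      Measure.map_apply (measurable_of_countable _) (measurableSet_singleton x),
      ← Equiv.image_eq_preimage_symm, Set.image_singleton, h x hx]
  · rw [Set.singleton_inter_eq_empty.2 hx]
    simp

lemma ScalesOn.rnRatio_eq [IsFiniteMeasure μ] (hγ : Measurable γ.symm) (hB : MeasurableSet B)
    (h : ScalesOn μ γ c B) : ∀ᵐ y ∂μ, y ∈ B → rnRatio μ γ y = c := by
  have h1 := Measure.rnDeriv_restrict (μ.map γ.symm) μ hB
  have h2 := Measure.rnDeriv_smul_left (μ.restrict B) μ c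
  rw [h.restrict_eq hγ hB] at h1
  filter_upwards [h1, h2, Measure.rnDeriv_restrict_self μ hB] with y h1 h2 h3 hy
  rw [h1, Set.indicator_of_mem hy, Pi.smul_apply, h3, Set.indicator_of_mem hy] at h2
  simp [rnRatio, h2, ENNReal.smul_def]

/-- `c` is a multiplicative essential value of `Γ`, witnessed by subsets on which an element of `Γ`
scales the measure exactly by `c`. -/
def IsScalingValue (μ : Measure Y) (Γ : Subgroup (Equiv.Perm Y)) (c : ℝ≥0) : Prop :=
  ∀ A : Set Y, MeasurableSet A → 0 < μ A → ∃ B : Set Y, B ⊆ A ∧ MeasurableSet B ∧ 0 < μ B ∧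
    ∃ γ ∈ Γ, γ '' B ⊆ A ∧ ScalesOn μ γ c B

variable {Γ : Subgroup (Equiv.Perm Y)}

lemma isScalingValue_one : IsScalingValue μ Γ 1 := fun A hA h0 =>
  ⟨A, subset_rfl, hA, h0, 1, Γ.one_mem, by simp, fun S _ _ => by simp⟩

/-- The second value is realised inside the image of the first piece, and the resulting set is
pulled back; scaling factors multiply under composition. -/
lemma IsScalingValue.mul (hΓ : ∀ γ ∈ Γ, IsNonsingular μ γ) (h0 : c ≠ 0)
    (h : IsScalingValue μ Γ c) (h' : IsScalingValue μ Γ c') : IsScalingValue μ Γ (c' * c) := by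
  intro A hA hpos
  obtain ⟨B, hBA, hB, hBpos, γ, hγ, hγB, hs⟩ := h A hA hpos
  have hpos' : 0 < μ (γ '' B) := by
    rw [hs B subset_rfl hB]
    exact ENNReal.mul_pos (by simpa using h0) hBpos.ne'
  obtain ⟨B', hBB', hB', hBpos', γ', hγ', hγB', hs'⟩ :=
    h' (γ '' B) (measurableSet_image_perm (hΓ γ hγ).2.1 hB) hpos'
  have hsub : γ ⁻¹' B' ⊆ B := by
    intro x hx
    obtain ⟨y, hy, hxy⟩ := hBB' hx
    rwa [γ.injective hxy] at hy
  have himg : γ '' (γ ⁻¹' B') = B' := Set.image_preimage_eq _ γ.surjective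
  have hm : MeasurableSet (γ ⁻¹' B') := (hΓ γ hγ).1 hB'
  refine ⟨γ ⁻¹' B', hsub.trans hBA, hm, ?_, γ' * γ, Γ.mul_mem hγ' hγ, ?_,
    (hs.mono hsub).trans (hΓ γ hγ).2.1 (by rwa [himg])⟩
  · have := hs _ hsub hm
    rw [himg] at this
    rw [this] at hBpos'
    exact pos_of_mul_pos_right hBpos' (by simp)
  · rintro _ ⟨x, hx, rfl⟩
    exact hγB (hγB' ⟨γ x, hx, rfl⟩)

lemma IsScalingValue.inv (hΓ : ∀ γ ∈ Γ, IsNonsingular μ γ) (h0 : c ≠ 0)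
    (h : IsScalingValue μ Γ c) : IsScalingValue μ Γ c⁻¹ := by
  intro A hA hpos
  obtain ⟨B, hBA, hB, hBpos, γ, hγ, hγB, hs⟩ := h A hA hpos
  refine ⟨γ '' B, hγB, measurableSet_image_perm (hΓ γ hγ).2.1 hB, ?_, γ⁻¹, Γ.inv_mem hγ, ?_,
    hs.inv (hΓ γ hγ).1 h0⟩
  · rw [hs B subset_rfl hB]
    exact ENNReal.mul_pos (by simpa using h0) hBpos.ne'
  · rw [Equiv.Perm.inv_def, Equiv.image_symm_eq_preimage, Set.preimage_image_eq _ γ.injective]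
    exact hBA

lemma IsScalingValue.zpow (hΓ : ∀ γ ∈ Γ, IsNonsingular μ γ) (h0 : c ≠ 0)
    (h : IsScalingValue μ Γ c) (n : ℤ) : IsScalingValue μ Γ (c ^ n) := by
  induction n using Int.induction_on with
  | zero => simpa using isScalingValue_one
  | succ n ih =>
    rw [zpow_add_one₀ h0]
    exact h.mul hΓ h0 ih
  | pred n ih =>
    rw [zpow_sub_one₀ h0]
    exact (h.inv hΓ h0).mul hΓ (inv_ne_zero h0) ih

/-- Exact scaling determines the derivative only almost everywhere, while an essential value asks
for every point of `B`; the exceptional null set is removed from `B`. -/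
lemma IsScalingValue.isEssentialValue [IsFiniteMeasure μ] (hΓ : ∀ γ ∈ Γ, IsNonsingular μ γ)
    (h : IsScalingValue μ Γ c) : IsEssentialValue μ Γ (Real.log c) := by
  intro A hA hpos U hU
  obtain ⟨B, hBA, hB, hBpos, γ, hγ, hγB, hs⟩ := h A hA hpos
  have hae := hs.rnRatio_eq (hΓ γ hγ).2.1 hB
  have hmeas : MeasurableSet {y | rnRatio μ γ y = c} :=
    measurableSet_eq_fun (Measure.measurable_rnDeriv _ _).ennreal_toReal measurable_const
  refine ⟨B ∩ {y | rnRatio μ γ y = c}, Set.inter_subset_left.trans hBA, hB.inter hmeas, ?_, γ, hγ,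
    (Set.image_mono Set.inter_subset_left).trans hγB, ?_⟩
  · refine hBpos.trans_le (measure_mono_ae ?_)
    filter_upwards [hae] with y hy hyB using ⟨hyB, hy hyB⟩
  · rintro y ⟨-, hy⟩
    rw [logRN, hy]
    exact mem_of_mem_nhds hU

end Scaling

/-! ### Scaling by product maps on infinite product measures -/

section Product

variable {X : ℕ → Type*}

lemma univ_pi_eq_iInter_range (v : ∀ n, Set (X n)) :
    Set.univ.pi v = ⋂ M, Set.pi (Finset.range M : Set ℕ) v := by
  ext x
  simp only [Set.mem_pi, Set.mem_univ, forall_const, Set.mem_iInter, Finset.coe_range,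
    Set.mem_Iio]
  exact ⟨fun h _ n _ => h n, fun h n => h (n + 1) n (Nat.lt_succ_self n)⟩

lemma piCongrRight_symm_coe (g : ∀ n, Equiv.Perm (X n)) :
    ⇑(Equiv.piCongrRight g).symm = fun x n => (g n).symm (x n) := rfl

variable [∀ n, MeasurableSpace (X n)]

lemma tendsto_infinitePi_range (μ : ∀ n, Measure (X n)) [∀ n, IsProbabilityMeasure (μ n)]
    (v : ∀ n, Set (X n)) (hv : ∀ n, MeasurableSet (v n)) :
    Tendsto (fun M => ∏ n ∈ Finset.range M, μ n (v n)) atTop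
      (𝓝 (Measure.infinitePi μ (Set.univ.pi v))) := by
  have := tendsto_measure_iInter_atTop (μ := Measure.infinitePi μ)
    (s := fun M => Set.pi (Finset.range M : Set ℕ) v)
    (fun M => (MeasurableSet.pi (Finset.countable_toSet _) fun n _ => hv n).nullMeasurableSet)
    (fun M N h => Set.pi_mono' (fun _ _ => subset_rfl) (by simpa using h))
    ⟨0, measure_ne_top _ _⟩
  rw [← univ_pi_eq_iInter_range] at this
  refine this.congr fun M => ?_
  exact Measure.infinitePi_pi μ fun n _ => hv n

/-- Both box measures are limits of finite products, and from index `k` on the ratio of these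
products is constant. -/
lemma infinitePi_pi_smul (μ ν : ∀ n, Measure (X n)) [∀ n, IsProbabilityMeasure (μ n)]
    [∀ n, IsProbabilityMeasure (ν n)] (c : ℕ → ℝ≥0) (k : ℕ) (hc : ∀ n, k ≤ n → c n = 1)
    (v : ∀ n, Set (X n)) (hv : ∀ n, MeasurableSet (v n)) (h : ∀ n, ν n (v n) = c n * μ n (v n)) :
    Measure.infinitePi ν (Set.univ.pi v) =
      (∏ n ∈ Finset.range k, c n : ℝ≥0) * Measure.infinitePi μ (Set.univ.pi v) := by
  refine tendsto_nhds_unique (tendsto_infinitePi_range ν v hv) ?_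
  refine (ENNReal.Tendsto.const_mul (tendsto_infinitePi_range μ v hv)
    (Or.inr ENNReal.coe_ne_top)).congr' ?_
  filter_upwards [eventually_ge_atTop k] with M hM
  have : ∏ n ∈ Finset.range k, c n = ∏ n ∈ Finset.range M, c n :=
    Finset.prod_subset (Finset.range_mono hM) fun n _ hn => hc n (by simpa using hn)
  rw [this]
  push_cast
  rw [← Finset.prod_mul_distrib]
  exact Finset.prod_congr rfl fun n _ => (h n).symm

/-- Intersecting with the box `t` turns boxes into boxes, so the two sides agree on the π-system of
square cylinders. -/
lemma infinitePi_restrict_smul (μ ν : ∀ n, Measure (X n)) [∀ n, IsProbabilityMeasure (μ n)]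
    [∀ n, IsProbabilityMeasure (ν n)] (c : ℕ → ℝ≥0) (k : ℕ) (hc : ∀ n, k ≤ n → c n = 1)
    (t : ∀ n, Set (X n)) (ht : ∀ n, MeasurableSet (t n))
    (h : ∀ n, (ν n).restrict (t n) = c n • (μ n).restrict (t n)) :
    (Measure.infinitePi ν).restrict (Set.univ.pi t) =
      (∏ n ∈ Finset.range k, c n) • (Measure.infinitePi μ).restrict (Set.univ.pi t) := by
  have hT : MeasurableSet (Set.univ.pi t) := MeasurableSet.univ_pi ht
  have key : ∀ u : ∀ n, Set (X n), (∀ n, MeasurableSet (u n)) →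
      (Measure.infinitePi ν).restrict (Set.univ.pi t) (Set.univ.pi u) =
      ((∏ n ∈ Finset.range k, c n) • (Measure.infinitePi μ).restrict (Set.univ.pi t))
        (Set.univ.pi u) := by
    intro u hu
    rw [Measure.smul_apply, Measure.restrict_apply (MeasurableSet.univ_pi hu),
      Measure.restrict_apply (MeasurableSet.univ_pi hu), ← Set.pi_inter_distrib,
      ENNReal.smul_def, smul_eq_mul]
    refine infinitePi_pi_smul μ ν c k hc _ (fun n => (hu n).inter (ht n)) fun n => ?_
    have := congrArg (fun m => m (u n)) (h n)
    simpa only [Measure.smul_apply, Measure.restrict_apply (hu n), ENNReal.smul_def,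
      smul_eq_mul] using this
  refine ext_of_generate_finite _ generateFrom_squareCylinders.symm
    (isPiSystem_squareCylinders (fun _ => MeasurableSpace.isPiSystem_measurableSet) (by simp))
    ?_ ?_
  · rintro _ ⟨s, u, hu, rfl⟩
    classical
    have : Set.pi (s : Set ℕ) u = Set.univ.pi fun n => if n ∈ s then u n else Set.univ := by
      ext x
      simp only [Set.mem_pi, Set.mem_univ, forall_const]
      refine forall_congr' fun n => ?_
      by_cases hn : n ∈ s <;> simp [hn]
    rw [this]
    refine key _ fun n => ?_
    split_ifs
    · exact hu n (Set.mem_univ n)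
    · exact MeasurableSet.univ
  · rw [← Set.pi_univ (Set.univ : Set ℕ)]
    exact key _ fun n => MeasurableSet.univ

lemma scalesOn_piCongrRight [∀ n, Countable (X n)] [∀ n, MeasurableSingletonClass (X n)]
    (μ : ∀ n, Measure (X n)) [∀ n, IsProbabilityMeasure (μ n)] (g : ∀ n, Equiv.Perm (X n))
    (c : ℕ → ℝ≥0) (k : ℕ) (hc : ∀ n, k ≤ n → c n = 1) (t : ∀ n, Set (X n))
    (h : ∀ n, ∀ x ∈ t n, μ n {g n x} = c n * μ n {x}) :
    ScalesOn (Measure.infinitePi μ) (Equiv.piCongrRight g) (∏ n ∈ Finset.range k, c n)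
      (Set.univ.pi t) := by
  have hm : ∀ n, Measurable (g n).symm := fun n => measurable_of_countable _
  have hmeas : Measurable (Equiv.piCongrRight g).symm := by
    rw [piCongrRight_symm_coe]
    exact measurable_pi_lambda _ fun n => (hm n).comp (measurable_pi_apply n)
  have : ∀ n, IsProbabilityMeasure ((μ n).map (g n).symm) := fun n =>
    Measure.isProbabilityMeasure_map (hm n).aemeasurable
  refine scalesOn_of_restrict_eq hmeas ?_
  rw [piCongrRight_symm_coe, Measure.infinitePi_map_pi μ hm]
  exact infinitePi_restrict_smul μ _ c k hc t (fun n => (t n).to_countable.measurableSet)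
    fun n => restrict_map_symm_eq_of_singleton (h n)

end Product

/-! ### Comparing measures through cylinders -/

section Cylinders

variable {X : ℕ → Type*}

/-- The cylinder of all points that agree with `x` in the first `k` coordinates. -/
def cyl (k : ℕ) (x : ∀ n, X n) : Set (∀ n, X n) :=
  Set.pi (Finset.range k : Set ℕ) fun n => {x n}

lemma mem_cyl {k : ℕ} {x y : ∀ n, X n} : y ∈ cyl k x ↔ ∀ n < k, y n = x n := by
  simp [cyl]

lemma preimage_restrict_singleton (k : ℕ) (x : ∀ n, X n) :
    (Finset.range k).restrict ⁻¹' {(Finset.range k).restrict x} = cyl k x := by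
  ext y
  simp only [Set.mem_preimage, Set.mem_singleton_iff, mem_cyl, funext_iff, Finset.restrict,
    Subtype.forall, Finset.mem_range]

variable [∀ n, MeasurableSpace (X n)]

lemma exists_range_restrict_preimage {C : Set (∀ n, X n)} (hC : C ∈ measurableCylinders X) :
    ∃ K, ∀ k, K ≤ k → ∃ D : Set (∀ n : Finset.range k, X n),
      C = (Finset.range k).restrict ⁻¹' D := by
  obtain ⟨s, S, -, rfl⟩ := (mem_measurableCylinders C).1 hC
  obtain ⟨K, hK⟩ := s.exists_nat_subset_range
  refine ⟨K, fun k hk => ⟨Finset.restrict₂ (hK.trans (Finset.range_mono hk)) ⁻¹' S, ?_⟩⟩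
  rfl

lemma exists_measurableCylinder_symmDiff_lt (μ : Measure (∀ n, X n)) [IsFiniteMeasure μ]
    {A : Set (∀ n, X n)} (hA : MeasurableSet A) {ε : ℝ≥0∞} (hε : ε ≠ 0) :
    ∃ C ∈ measurableCylinders X, μ (symmDiff C A) < ε := by
  obtain ⟨C, hC, h⟩ := exists_measure_symmDiff_lt_of_generateFrom_isSetRing (μ := μ)
    isSetRing_measurableCylinders
    ⟨{Set.univ}, Set.countable_singleton _, by simpa using univ_mem_measurableCylinders X, by simp⟩
    generateFrom_measurableCylinders.symm hA hε.bot_lt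
  exact ⟨C, hC, h⟩

variable [∀ n, MeasurableSingletonClass (X n)]

lemma measurableSet_cyl (k : ℕ) (x : ∀ n, X n) : MeasurableSet (cyl k x) :=
  MeasurableSet.pi (Finset.countable_toSet _) fun _ _ => measurableSet_singleton _

variable [∀ n, Finite (X n)] [∀ n, Nonempty (X n)]

/-- A set depending on the first `k` coordinates is a finite disjoint union of depth-`k` cylinders.
-/
lemma restrict_preimage_le_of_cyl_le {α β : Measure (∀ n, X n)} {k : ℕ}
    (h : ∀ x, α (cyl k x) ≤ β (cyl k x)) (D : Set (∀ n : Finset.range k, X n)) :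
    α ((Finset.range k).restrict ⁻¹' D) ≤ β ((Finset.range k).restrict ⁻¹' D) := by
  have hmeas := (Finset.range k).measurable_restrict (X := X)
  have hD : MeasurableSet D := D.toFinite.measurableSet
  have key : ∀ m : Measure (∀ n, X n), m ((Finset.range k).restrict ⁻¹' D) =
      ∑ d ∈ D.toFinite.toFinset, m ((Finset.range k).restrict ⁻¹' {d}) := by
    intro m
    rw [← Measure.map_apply hmeas hD]
    simp_rw [← Measure.map_apply hmeas (measurableSet_singleton _)]
    rw [sum_measure_singleton, Set.Finite.coe_toFinset]
  rw [key, key]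
  refine Finset.sum_le_sum fun d _ => ?_
  classical
  obtain ⟨x, rfl⟩ : ∃ x : ∀ n, X n, (Finset.range k).restrict x = d :=
    ⟨fun n => if hn : n ∈ Finset.range k then d ⟨n, hn⟩ else Classical.arbitrary _, by
      ext ⟨n, hn⟩
      simp [Finset.restrict, Finset.mem_range.1 hn]⟩
  rw [preimage_restrict_singleton]
  exact h x

lemma measure_univ_le_of_cyl_le {α β : Measure (∀ n, X n)} {k : ℕ}
    (h : ∀ x, α (cyl k x) ≤ β (cyl k x)) : α Set.univ ≤ β Set.univ := by
  simpa using restrict_preimage_le_of_cyl_le h Set.univ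

/-- A comparison of two measures that holds up to a vanishing error on all small cylinders
holds everywhere. -/
lemma le_of_cyl_le {α β μ : Measure (∀ n, X n)} [IsFiniteMeasure α] [IsFiniteMeasure β]
    [IsFiniteMeasure μ]
    (h : ∀ δ : ℝ≥0, 0 < δ → ∃ k₀, ∀ k, k₀ ≤ k → ∀ x,
      α (cyl k x) ≤ β (cyl k x) + δ * μ (cyl k x)) {A : Set (∀ n, X n)} (hA : MeasurableSet A) :
    α A ≤ β A := by
  have hC : ∀ C ∈ measurableCylinders X, α C ≤ β C := by
    intro C hC
    obtain ⟨K, hK⟩ := exists_range_restrict_preimage hC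
    have h1 : ∀ δ : ℝ≥0, 0 < δ → α C ≤ β C + δ * μ C := by
      intro δ hδ
      obtain ⟨k₀, hk₀⟩ := h δ hδ
      obtain ⟨D, rfl⟩ := hK (max K k₀) (le_max_left _ _)
      have hs : ∀ s, (β + δ • μ) s = β s + δ * μ s := fun s => by
        rw [Measure.add_apply, Measure.smul_apply, ENNReal.smul_def, smul_eq_mul]
      have := restrict_preimage_le_of_cyl_le (α := α) (β := β + δ • μ)
        (fun x => by rw [hs]; exact hk₀ _ (le_max_right K k₀) x) D
      rwa [hs] at this
    refine ENNReal.le_of_forall_pos_le_add fun ε hε _ => ?_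
    -- The added `1` keeps the divisor positive when `μ C = 0`.
    have hpos : 0 < ε / ((μ C).toNNReal + 1) := by positivity
    refine (h1 _ hpos).trans (add_le_add le_rfl ?_)
    rw [← ENNReal.coe_toNNReal (measure_ne_top μ C), ← ENNReal.coe_mul, ENNReal.coe_le_coe]
    rw [div_mul_eq_mul_div, div_le_iff₀ (by positivity)]
    simp only [ENNReal.toNNReal_coe]
    gcongr
    simp
  refine ENNReal.le_of_forall_pos_le_add fun ε hε _ => ?_
  have hε2 : ((ε / 2 : ℝ≥0) : ℝ≥0∞) ≠ 0 := by
    have : (0 : ℝ≥0) < ε / 2 := by positivity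
    simpa using this.ne'
  -- Approximating with respect to `α + β` gives one cylinder set that is close to `A` for both
  -- measures.
  obtain ⟨C, hCm, hCA⟩ := exists_measurableCylinder_symmDiff_lt (α + β) hA hε2
  rw [Measure.add_apply] at hCA
  have e1 : α A ≤ α C + α (symmDiff C A) := by
    refine (measure_mono fun x hx => ?_).trans (measure_union_le _ _)
    by_cases hxC : x ∈ C
    · exact Or.inl hxC
    · exact Or.inr (Or.inr ⟨hx, hxC⟩)
  have e2 : β C ≤ β A + β (symmDiff C A) := by
    refine (measure_mono fun x hx => ?_).trans (measure_union_le _ _)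
    by_cases hxA : x ∈ A
    · exact Or.inl hxA
    · exact Or.inr (Or.inl ⟨hx, hxA⟩)
  calc α A ≤ α C + α (symmDiff C A) := e1
    _ ≤ β A + β (symmDiff C A) + α (symmDiff C A) := by gcongr; exact (hC C hCm).trans e2
    _ = β A + (α (symmDiff C A) + β (symmDiff C A)) := by ring
    _ ≤ β A + ε := by
      gcongr
      refine hCA.le.trans ?_
      exact_mod_cast half_le_self (zero_le (a := ε))

/-- Each depth has finitely many cylinders and there are countably many depths, so the exceptional
null sets add up to a null set. -/
lemma ae_of_forall_cyl {μ : Measure (∀ n, X n)} {E : ℕ → Set (∀ n, X n)}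
    (hE : ∀ᵐ x ∂μ, ∃ N, x ∈ E N) {P : (∀ n, X n) → Prop}
    (h : ∀ N x₀, ∀ᵐ x ∂μ, x ∈ cyl N x₀ ∩ E N → P x) : ∀ᵐ x ∂μ, P x := by
  have h1 : ∀ N, ∀ᵐ x ∂μ, x ∈ E N → P x := by
    intro N
    have h2 := measure_univ_le_of_cyl_le (α := μ.restrict {x | ¬ (x ∈ E N → P x)}) (β := 0)
      (k := N) (fun x₀ => by
        rw [Measure.restrict_apply (measurableSet_cyl N x₀)]
        refine (measure_mono_null (fun x hx => ?_) (h N x₀)).le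
        exact fun hP => hx.2 fun hxE => hP ⟨hx.1, hxE⟩)
    rw [Measure.restrict_apply MeasurableSet.univ, Set.univ_inter] at h2
    exact le_antisymm h2 bot_le
  filter_upwards [hE, ae_all_iff.2 h1] with x hx hx1
  obtain ⟨N, hN⟩ := hx
  exact hx1 N hN

end Cylinders

/-! ### The two-level measure on one cyclic factor -/

section Level

variable {l : ℝ≥0} {p : ℕ}

lemma inv_two_le_one : (2⁻¹ : ℝ≥0∞) ≤ 1 := ENNReal.inv_le_one.2 one_le_two

lemma finRotate_pow_val [NeZero p] (m : ℕ) (x : Fin p) :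
    (((finRotate p) ^ m) x : ℕ) = (x + m) % p := by
  induction m with
  | zero => simp [Nat.mod_eq_of_lt x.isLt]
  | succ m ih =>
    rw [pow_succ', Equiv.Perm.mul_apply, finRotate_apply, Fin.val_add, ih, Fin.val_one',
      ← add_assoc, Nat.add_mod (x + m) 1]

lemma finRotate_pow_eq_of_modEq [NeZero p] {m m' : ℕ} (h : m ≡ m' [MOD p]) :
    (finRotate p) ^ m = (finRotate p) ^ m' := by
  ext x
  rw [finRotate_pow_val, finRotate_pow_val]
  exact Nat.ModEq.add_left _ h

lemma exists_finRotate_pow_eq [NeZero p] (x y : Fin p) : ∃ m : ℕ, ((finRotate p) ^ m) x = y := by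
  refine ⟨y + (p - x), Fin.ext ?_⟩
  rw [finRotate_pow_val, show (x : ℕ) + (y + (p - x)) = y + p by have := x.isLt; omega,
    Nat.add_mod_right, Nat.mod_eq_of_lt y.isLt]

lemma levelWeight_pos (hl : 0 < l) (x : Fin p) : 0 < levelWeight l p x := by
  unfold levelWeight
  split_ifs
  · exact one_pos
  · exact_mod_cast hl

lemma sum_levelWeight_pos (hl : 0 < l) [NeZero p] : 0 < ∑ x : Fin p, levelWeight l p x :=
  Finset.sum_pos (fun x _ => levelWeight_pos hl x) Finset.univ_nonempty

lemma levelMeasure_singleton (lam : ℝ) (x : Fin p) :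
    levelMeasure lam p {x} =
      ENNReal.ofReal (levelWeight lam p x / ∑ i : Fin p, levelWeight lam p i) := by
  classical
  rw [levelMeasure, Measure.finsetSum_apply]
  simp only [Measure.smul_apply, smul_eq_mul]
  rw [Finset.sum_eq_single x]
  · simp
  · intro b _ hb
    simp [hb]
  · simp

instance isProbabilityMeasure_levelMeasure [hl : Fact (0 < l)] [NeZero p] :
    IsProbabilityMeasure (levelMeasure l p) := by
  constructor
  have := sum_measure_singleton (s := (Finset.univ : Finset (Fin p))) (μ := levelMeasure l p)
  rw [Finset.coe_univ] at this
  rw [← this]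
  simp_rw [levelMeasure_singleton]
  have h0 := sum_levelWeight_pos (p := p) hl.out
  rw [← ENNReal.ofReal_sum_of_nonneg fun x _ => div_nonneg (levelWeight_pos hl.out x).le h0.le,
    ← Finset.sum_div, div_self h0.ne', ENNReal.ofReal_one]

lemma levelMeasure_singleton_pos (hl : 0 < l) [NeZero p] (x : Fin p) :
    0 < levelMeasure l p {x} := by
  rw [levelMeasure_singleton, ENNReal.ofReal_pos]
  exact div_pos (levelWeight_pos hl x) (sum_levelWeight_pos hl)

/-- The ratio of the weights of two points. -/
def levelRatio (l : ℝ≥0) (p : ℕ) (x y : Fin p) : ℝ≥0 :=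
  (levelWeight l p y / levelWeight l p x).toNNReal

lemma levelMeasure_singleton_eq_mul (hl : 0 < l) [NeZero p] (x y : Fin p) :
    levelMeasure l p {y} = levelRatio l p x y * levelMeasure l p {x} := by
  have hx := levelWeight_pos hl x
  have h0 := sum_levelWeight_pos (p := p) hl
  rw [levelMeasure_singleton, levelMeasure_singleton, levelRatio]
  change _ = ENNReal.ofReal _ * _
  rw [← ENNReal.ofReal_mul (div_nonneg (levelWeight_pos hl y).le hx.le)]
  congr 1
  field_simp

lemma levelRatio_eq_one (hl : 0 < l) {x y : Fin p} (h : levelWeight l p y = levelWeight l p x) :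
    levelRatio l p x y = 1 := by
  rw [levelRatio, h, div_self (levelWeight_pos hl x).ne', Real.toNNReal_one]

lemma exists_levelRatio_eq_zpow (x y : Fin p) : ∃ z : ℤ, levelRatio l p x y = l ^ z := by
  unfold levelRatio levelWeight
  split_ifs
  · exact ⟨0, by simp⟩
  · exact ⟨-1, by simp [zpow_neg, Real.toNNReal_inv]⟩
  · exact ⟨1, by simp⟩
  · rcases eq_or_ne l 0 with rfl | h
    · exact ⟨1, by simp⟩
    · exact ⟨0, by simp [h]⟩

end Level

/-! ### Consequences of fastness in the factors and in the tails -/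

section Sequence

variable {l : ℝ≥0} {p : ℕ → ℕ}

/-- A point of `Y_k` is more than `P_k` steps away from the end of its level, so `j` steps neither
cross the midpoint nor wrap around. -/
lemma levelWeight_finRotate_pow {k j : ℕ} [NeZero (p k)] (hj : j ≤ partialProd p k)
    {x : Fin (p k)} (hx : x ∈ setY p k) :
    levelWeight l (p k) ((finRotate (p k) ^ j) x) = levelWeight l (p k) x := by
  have hj' : (j : ℝ) ≤ partialProd p k := by exact_mod_cast hj
  have hlt : (x : ℕ) + j < p k := by
    have hp0 : (0 : ℝ) ≤ p k := Nat.cast_nonneg _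
    have : ((x : ℕ) : ℝ) + j < p k := by
      rcases hx with hx | hx
      · have hx : ((x : ℕ) : ℝ) < (p k : ℝ) / 2 - partialProd p k := hx
        linarith
      · have hx : ((x : ℕ) : ℝ) < (p k : ℝ) - partialProd p k := hx.2
        linarith
    exact_mod_cast this
  have hval : ((((finRotate (p k) ^ j) x : Fin (p k)) : ℕ) : ℝ) = (x : ℕ) + j := by
    rw [finRotate_pow_val, Nat.mod_eq_of_lt hlt, Nat.cast_add]
  have hj0 : (0 : ℝ) ≤ j := Nat.cast_nonneg _
  unfold levelWeight
  rw [hval]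
  rcases hx with hx | hx
  · have hx : ((x : ℕ) : ℝ) < (p k : ℝ) / 2 - partialProd p k := hx
    rw [if_pos (by linarith), if_pos (by linarith)]
  · have hx : (p k : ℝ) / 2 < ((x : ℕ) : ℝ) := hx.1
    rw [if_neg (by linarith), if_neg (by linarith)]

lemma levelRatio_finRotate_half {k : ℕ} [NeZero (p k)] {x : Fin (p k)} (hpos : 0 < partialProd p k)
    (hx : x ∈ setZ p k) :
    levelRatio l (p k) x ((finRotate (p k) ^ (p k / 2)) x) = l := by
  have h1 : ((partialProd p k : ℕ) : ℝ) < (x : ℕ) := hx.1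
  have h2 : ((x : ℕ) : ℝ) < (p k : ℝ) / 2 := hx.2
  have h3 : partialProd p k < (x : ℕ) := by exact_mod_cast h1
  have h4 : 2 * (x : ℕ) < p k := by
    have : 2 * ((x : ℕ) : ℝ) < p k := by linarith
    exact_mod_cast this
  have hval : (((finRotate (p k) ^ (p k / 2)) x : Fin (p k)) : ℕ) = x + p k / 2 := by
    rw [finRotate_pow_val, Nat.mod_eq_of_lt (by omega)]
  -- The floor in `p k / 2` may lose one half; `x > P_k ≥ 1` makes up for it.
  have h5 : (p k : ℝ) / 2 < ((x : ℕ) : ℝ) + ((p k / 2 : ℕ) : ℝ) := by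
    have : (p k : ℝ) < 2 * (((x : ℕ) : ℝ) + ((p k / 2 : ℕ) : ℝ)) := by
      have : p k < 2 * ((x : ℕ) + p k / 2) := by omega
      exact_mod_cast this
    linarith
  unfold levelRatio levelWeight
  rw [hval, Nat.cast_add, if_neg (by linarith), if_pos h2.le]
  simp

lemma exists_lt_partialProd_modEq (hp : IsCoprimeSeq p) (a : ℕ → ℕ) (k : ℕ) :
    ∃ j < partialProd p k, ∀ n < k, j ≡ a n [MOD p n] := by
  have hc : (Finset.range k : Set ℕ).Pairwise (Function.onFun Nat.Coprime p) :=
    fun i _ j _ hij => hp.coprime hij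
  refine ⟨Nat.chineseRemainderOfFinset a p (Finset.range k) (fun i _ => (hp.pos i).ne') hc,
    Nat.chineseRemainderOfFinset_lt_prod a p (fun i _ => (hp.pos i).ne') hc, fun n hn => ?_⟩
  exact (Nat.chineseRemainderOfFinset a p (Finset.range k) (fun i _ => (hp.pos i).ne') hc).2 n
    (Finset.mem_range.2 hn)

lemma partialProd_pos (hp : IsCoprimeSeq p) (k : ℕ) : 0 < partialProd p k :=
  Finset.prod_pos fun n _ => hp.pos n

/-- Only `p 0 = 1` has to be excluded; there `Y_0` would be empty, against its mass bound. This
makes `partialProd` strictly increasing. -/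
lemma IsFast.one_lt (hf : IsFast l p) (hp : IsCoprimeSeq p) (n : ℕ) : 1 < p n := by
  by_contra hcon
  have hn : n = 0 := by
    by_contra h0
    have := hp.strictMono (Nat.pos_of_ne_zero h0)
    have := hp.pos 0
    omega
  subst hn
  have h1 : p 0 = 1 := by have := hp.pos 0; omega
  have h2 := hf.measure_setY 0
  have h3 : setY p 0 = ∅ := by
    ext x
    have hx : ((x : ℕ) : ℝ) = 0 := by
      have := x.isLt
      exact_mod_cast (by omega : (x : ℕ) = 0)
    simp only [setY, Set.mem_union, Set.mem_ofPred_eq, Set.mem_empty_iff_false, hx, h1, partialProd]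
    norm_num
  rw [h3] at h2
  norm_num at h2

lemma strictMono_partialProd (hp : IsCoprimeSeq p) (h1 : ∀ n, 1 < p n) :
    StrictMono (partialProd p) := by
  refine strictMono_nat_of_lt_succ fun n => ?_
  rw [partialProd, partialProd, Finset.prod_range_succ]
  exact lt_mul_of_one_lt_right (partialProd_pos hp n) (h1 n)

lemma prodRotation_pow (j : ℕ) :
    prodRotation p ^ j = Equiv.piCongrRight fun n => finRotate (p n) ^ j := by
  induction j with
  | zero => rfl
  | succ j ih =>
    simp only [pow_succ, ih]
    rfl

lemma prodRotation_zpow (j : ℤ) :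
    prodRotation p ^ j = Equiv.piCongrRight fun n => finRotate (p n) ^ j := by
  cases j with
  | ofNat j => exact prodRotation_pow j
  | negSucc j =>
    rw [zpow_negSucc, prodRotation_pow]
    rfl

/-- The points whose coordinates from `k` on lie in the sets `Y_n`. -/
def tailY (p : ℕ → ℕ) (k : ℕ) : Set (∀ n, Fin (p n)) := {x | ∀ n, k ≤ n → x n ∈ setY p n}

lemma measurableSet_tailY (k : ℕ) : MeasurableSet (tailY p k) := by
  have : tailY p k = Set.pi (Set.Ici k) fun n => setY p n := rfl
  rw [this]
  exact MeasurableSet.pi (Set.to_countable _) fun _ _ => (Set.toFinite _).measurableSet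

variable [∀ n, NeZero (p n)] [hl : Fact (0 < l)]

lemma IsFast.measure_compl_setY_le (hf : IsFast l p) (n : ℕ) :
    levelMeasure l (p n) (setY p n)ᶜ ≤ 2⁻¹ ^ (n + 2) := by
  have hm : MeasurableSet (setY p n) := (Set.toFinite _).measurableSet
  have h := hf.measure_setY n
  have h2 := probReal_compl_eq_one_sub (μ := levelMeasure l (p n)) hm
  have h3 : (levelMeasure l (p n)).real (setY p n)ᶜ ≤ (2⁻¹ : ℝ) ^ (n + 2) := by
    rw [h2]
    rw [one_div] at h
    linarith
  rw [← ENNReal.ofReal_toReal (measure_ne_top (levelMeasure l (p n)) (setY p n)ᶜ)]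
  refine (ENNReal.ofReal_le_ofReal h3).trans_eq ?_
  rw [ENNReal.ofReal_pow (by norm_num), ENNReal.ofReal_inv_of_pos (by norm_num),
    ENNReal.ofReal_ofNat]

instance isProbabilityMeasure_prodMeasure : IsProbabilityMeasure (prodMeasure l p) := by
  unfold prodMeasure
  infer_instance

/-- A union bound over the first coordinates: by independence, each event `x n ∉ Y_n` with `n ≥ k`
costs at most the fraction `2^{-n-2}`, and these sum to `2^{-k-1}`. -/
lemma measure_pi_range_diff_tailY_le (hf : IsFast l p) (k : ℕ) (u : ∀ n, Set (Fin (p n))) :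
    prodMeasure l p (Set.pi (Finset.range k : Set ℕ) u \ tailY p k) ≤
      2⁻¹ ^ (k + 1) * prodMeasure l p (Set.pi (Finset.range k : Set ℕ) u) := by
  set Q := Set.pi (Finset.range k : Set ℕ) u
  have hsub : Q \ tailY p k ⊆ ⋃ i, Q ∩ {x | x (k + i) ∈ (setY p (k + i))ᶜ} := by
    rintro x ⟨hx, hx'⟩
    simp only [tailY, Set.mem_ofPred_eq, not_forall] at hx'
    obtain ⟨n, hn, hxn⟩ := hx'
    obtain ⟨i, rfl⟩ := Nat.exists_eq_add_of_le hn
    exact Set.mem_iUnion.2 ⟨i, hx, hxn⟩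
  have hterm : ∀ i, prodMeasure l p (Q ∩ {x | x (k + i) ∈ (setY p (k + i))ᶜ}) ≤
      prodMeasure l p Q * 2⁻¹ ^ (k + i + 2) := by
    intro i
    have hni : k + i ∉ Finset.range k := by simp
    have hset : Q ∩ {x | x (k + i) ∈ (setY p (k + i))ᶜ} =
        Set.pi (insert (k + i) (Finset.range k) : Finset ℕ)
          (Function.update u (k + i) (setY p (k + i))ᶜ) := by
      ext x
      simp only [Q, Set.mem_inter_iff, Set.mem_pi, Finset.coe_insert, Set.mem_insert_iff,
        forall_eq_or_imp, Function.update_self, Set.mem_ofPred_eq]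
      rw [and_comm]
      refine and_congr Iff.rfl (forall₂_congr fun n hn => ?_)
      rw [Function.update_of_ne]
      rintro rfl
      exact hni hn
    rw [hset, prodMeasure, Measure.infinitePi_pi _ fun n _ => (Set.toFinite _).measurableSet,
      Finset.prod_insert hni, Measure.infinitePi_pi _ fun n _ => (Set.toFinite _).measurableSet,
      mul_comm, Function.update_self]
    refine mul_le_mul' (le_of_eq (Finset.prod_congr rfl fun n hn => ?_))
      (hf.measure_compl_setY_le _)
    rw [Function.update_of_ne]
    rintro rfl
    exact hni hn
  refine (measure_mono hsub).trans ((measure_iUnion_le _).trans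
    ((ENNReal.tsum_le_tsum hterm).trans_eq ?_))
  have : ∀ i, (2⁻¹ : ℝ≥0∞) ^ (k + i + 2) = 2⁻¹ ^ (k + 2) * 2⁻¹ ^ i := fun i => by ring
  simp_rw [this]
  rw [ENNReal.tsum_mul_left, ENNReal.tsum_mul_left, ENNReal.tsum_geometric, mul_comm,
    ENNReal.one_sub_inv_two, inv_inv, pow_succ _ (k + 1), mul_assoc (2⁻¹ ^ (k + 1)),
    ENNReal.inv_mul_cancel (by norm_num) (by norm_num), mul_one]

lemma measure_compl_tailY_le (hf : IsFast l p) (k : ℕ) :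
    prodMeasure l p (tailY p k)ᶜ ≤ 2⁻¹ ^ (k + 1) := by
  have := measure_pi_range_diff_tailY_le hf k fun _ => Set.univ
  rwa [Set.pi_univ, measure_univ, mul_one, ← Set.compl_eq_univ_sdiff] at this

end Sequence

lemma zpow_neg_apply_self {α : Type*} (f : Equiv.Perm α) (j : ℤ) (x : α) :
    (f ^ (-j)) ((f ^ j) x) = x := by
  rw [← Equiv.Perm.mul_apply, ← zpow_add, neg_add_cancel, zpow_zero, Equiv.Perm.one_apply]

/-! ### Nonsingularity, the lattice of cocycle values, ergodicity -/

section Dynamics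

variable {l : ℝ≥0} {p : ℕ → ℕ}

/-- The points of the `n`-th factor at which the `j`-th power of the rotation keeps the level. -/
def sameLevel (l : ℝ≥0) (p : ℕ → ℕ) (j : ℤ) (n : ℕ) : Set (Fin (p n)) :=
  {x | levelWeight l (p n) ((finRotate (p n) ^ j) x) = levelWeight l (p n) x}

lemma setY_subset_sameLevel {j n : ℕ} [NeZero (p n)] (hj : j ≤ partialProd p n) :
    setY p n ⊆ sameLevel l p j n := fun x hx => by
  simpa [sameLevel] using levelWeight_finRotate_pow (l := l) hj hx

lemma image_sameLevel (j : ℤ) (n : ℕ) :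
    (finRotate (p n) ^ j) '' sameLevel l p j n = sameLevel l p (-j) n := by
  ext x
  constructor
  · rintro ⟨y, hy, rfl⟩
    have hy : levelWeight l (p n) ((finRotate (p n) ^ j) y) = levelWeight l (p n) y := hy
    simp only [sameLevel, Set.mem_ofPred_eq, zpow_neg_apply_self, hy]
  · intro hx
    refine ⟨(finRotate (p n) ^ (-j)) x, ?_, by simp [zpow_neg]⟩
    have hx : levelWeight l (p n) ((finRotate (p n) ^ (-j)) x) = levelWeight l (p n) x := hx
    simp only [sameLevel, Set.mem_ofPred_eq, hx]
    simp [zpow_neg]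

lemma measurable_prodRotation_zpow (j : ℤ) : Measurable (prodRotation p ^ j) := by
  rw [prodRotation_zpow]
  exact measurable_pi_lambda _ fun n => (measurable_of_countable _).comp (measurable_pi_apply n)

lemma prodRotation_zpow_apply (j : ℤ) (x : ∀ n, Fin (p n)) (n : ℕ) :
    (prodRotation p ^ j) x n = (finRotate (p n) ^ j) (x n) := by
  rw [prodRotation_zpow]
  rfl

lemma prodRotation_zpow_symm (j : ℤ) : (prodRotation p ^ j).symm = prodRotation p ^ (-j) := by
  rw [zpow_neg]
  rfl

lemma IsFast.le_partialProd (hf : IsFast l p) (hp : IsCoprimeSeq p) (n : ℕ) :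
    n ≤ partialProd p n :=
  (strictMono_partialProd hp (hf.one_lt hp)).le_apply

lemma measurableSet_cyl_inter (N : ℕ) (x₀ : ∀ n, Fin (p n)) (t : ∀ n, Set (Fin (p n))) :
    MeasurableSet (cyl N x₀ ∩ {x | ∀ n, N ≤ n → x n ∈ t n}) :=
  (measurableSet_cyl N x₀).inter (MeasurableSet.pi (s := Set.Ici N) (t := t)
    (Set.to_countable _) fun _ _ => (Set.toFinite _).measurableSet)

lemma levelRatio_ne_zero (hl : 0 < l) {n : ℕ} (x y : Fin (p n)) : levelRatio l (p n) x y ≠ 0 := by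
  rw [levelRatio, Ne, Real.toNNReal_eq_zero, not_le]
  exact div_pos (levelWeight_pos hl _) (levelWeight_pos hl _)

variable [∀ n, NeZero (p n)] [hl : Fact (0 < l)]

/-- The rotation power preserves measure where it keeps the level and maps that set onto the one for
`-j`. Estimates for negative powers thus reduce to positive ones. -/
lemma measure_sameLevel_neg (j : ℤ) (n : ℕ) :
    levelMeasure l (p n) (sameLevel l p (-j) n) = levelMeasure l (p n) (sameLevel l p j n) := by
  have : ScalesOn (levelMeasure l (p n)) (finRotate (p n) ^ j) 1 (sameLevel l p j n) :=
    scalesOn_of_restrict_eq (measurable_of_countable _)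
      (restrict_map_symm_eq_of_singleton fun x hx => by
        rw [levelMeasure_singleton_eq_mul hl.out x, levelRatio_eq_one hl.out hx])
  rw [← image_sameLevel, this _ subset_rfl (Set.toFinite _).measurableSet, ENNReal.coe_one,
    one_mul]

lemma measure_compl_sameLevel_le (hf : IsFast l p) (hp : IsCoprimeSeq p) (j : ℤ) {n : ℕ}
    (hn : j.natAbs ≤ n) : levelMeasure l (p n) (sameLevel l p j n)ᶜ ≤ 2⁻¹ ^ (n + 2) := by
  have h1 : levelMeasure l (p n) (sameLevel l p (j.natAbs : ℤ) n)ᶜ ≤ 2⁻¹ ^ (n + 2) :=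
    (measure_mono (Set.compl_subset_compl.2
      (setY_subset_sameLevel (hn.trans (hf.le_partialProd hp n))))).trans
      (hf.measure_compl_setY_le n)
  rcases Int.natAbs_eq j with h | h
  · rwa [← h] at h1
  · rw [h, prob_compl_eq_one_sub (Set.toFinite _).measurableSet, measure_sameLevel_neg,
      ← prob_compl_eq_one_sub (Set.toFinite _).measurableSet]
    exact h1

/-- Borel–Cantelli with the geometric bounds on the complements, valid once `n ≥ |j|` because `n ≤
P_n`. -/
lemma ae_eventually_mem_sameLevel (hf : IsFast l p) (hp : IsCoprimeSeq p) (j : ℤ) :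
    ∀ᵐ x ∂prodMeasure l p, ∃ N, ∀ n, N ≤ n → x n ∈ sameLevel l p j n := by
  have hsum : ∑' n, prodMeasure l p
      {x | j.natAbs ≤ n ∧ x n ∈ (sameLevel l p j n)ᶜ} ≠ ∞ := by
    have hle : ∀ n, prodMeasure l p {x | j.natAbs ≤ n ∧ x n ∈ (sameLevel l p j n)ᶜ} ≤
        2⁻¹ ^ 2 * 2⁻¹ ^ n := by
      intro n
      by_cases hn : j.natAbs ≤ n
      · have hset : {x : ∀ n, Fin (p n) | j.natAbs ≤ n ∧ x n ∈ (sameLevel l p j n)ᶜ} =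
            (fun x => x n) ⁻¹' (sameLevel l p j n)ᶜ := by
          ext x
          simp [hn]
        rw [hset, ← Measure.map_apply (measurable_pi_apply n) (Set.toFinite _).measurableSet,
          prodMeasure, Measure.infinitePi_map_eval, ← pow_add, add_comm 2 n]
        exact measure_compl_sameLevel_le hf hp j hn
      · simp [hn]
    refine ne_top_of_le_ne_top ?_ (ENNReal.tsum_le_tsum hle)
    rw [ENNReal.tsum_mul_left, ENNReal.tsum_geometric, ENNReal.one_sub_inv_two, inv_inv]
    exact ENNReal.mul_ne_top (by simp) (by simp)
  filter_upwards [ae_eventually_notMem hsum] with x hx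
  obtain ⟨N, hN⟩ := eventually_atTop.1 hx
  refine ⟨max N j.natAbs, fun n hn => ?_⟩
  by_contra hcon
  exact hN n ((le_max_left _ _).trans hn) ⟨(le_max_right _ _).trans hn, hcon⟩

lemma scalesOn_prodRotation (j : ℤ) (c : ℕ → ℝ≥0) (k : ℕ) (hc : ∀ n, k ≤ n → c n = 1)
    (t : ∀ n, Set (Fin (p n)))
    (h : ∀ n, ∀ x ∈ t n, levelRatio l (p n) x ((finRotate (p n) ^ j) x) = c n) :
    ScalesOn (prodMeasure l p) (prodRotation p ^ j) (∏ n ∈ Finset.range k, c n)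
      (Set.univ.pi t) := by
  rw [prodRotation_zpow]
  exact scalesOn_piCongrRight _ _ c k hc t fun n x hx => by
    rw [levelMeasure_singleton_eq_mul hl.out x, h n x hx]

lemma scalesOn_cyl_inter (j : ℤ) (N : ℕ) (x₀ : ∀ n, Fin (p n)) (t : ∀ n, Set (Fin (p n)))
    (ht : ∀ n, N ≤ n → t n ⊆ sameLevel l p j n) :
    ScalesOn (prodMeasure l p) (prodRotation p ^ j)
      (∏ n ∈ Finset.range N, levelRatio l (p n) (x₀ n) ((finRotate (p n) ^ j) (x₀ n)))
      (cyl N x₀ ∩ {x | ∀ n, N ≤ n → x n ∈ t n}) := by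
  have h := scalesOn_prodRotation (l := l) (p := p) j
    (fun n => if n < N then levelRatio l (p n) (x₀ n) ((finRotate (p n) ^ j) (x₀ n)) else 1) N
    (fun n hn => if_neg hn.not_gt) (fun n => if n < N then {x₀ n} else t n) (fun n x hx => by
      split_ifs with hn
      · rw [if_pos hn] at hx
        rw [Set.mem_singleton_iff.1 hx]
      · rw [if_neg hn] at hx
        exact levelRatio_eq_one hl.out (ht n (not_lt.1 hn) hx))
  rw [Finset.prod_congr rfl fun n hn => if_pos (Finset.mem_range.1 hn)] at h
  refine h.mono fun x hx n _ => ?_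
  beta_reduce
  split_ifs with hn
  · exact mem_cyl.1 hx.1 n hn
  · exact hx.2 n (not_lt.1 hn)

/-- On each piece `T^j` scales by a nonzero constant, so a null image forces a null set; the pieces
exhaust the space up to a null set. -/
lemma absolutelyContinuous_map_symm (hf : IsFast l p) (hp : IsCoprimeSeq p) (j : ℤ) :
    prodMeasure l p ≪ (prodMeasure l p).map (prodRotation p ^ j).symm := by
  have hm : Measurable (prodRotation p ^ j).symm := by
    rw [prodRotation_zpow_symm]
    exact measurable_prodRotation_zpow _
  refine Measure.AbsolutelyContinuous.mk fun S hS h0 => ?_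
  rw [Measure.map_apply hm hS, ← Equiv.image_eq_preimage_symm] at h0
  have : ∀ᵐ x ∂prodMeasure l p, x ∉ S := by
    refine ae_of_forall_cyl (E := fun N => {x | ∀ n, N ≤ n → x n ∈ sameLevel l p j n})
      (ae_eventually_mem_sameLevel hf hp j) fun N x₀ => ?_
    have h1 := scalesOn_cyl_inter (l := l) j N x₀ (sameLevel l p j) (fun _ _ => subset_rfl) _
      (Set.inter_subset_right (s := S)) (hS.inter (measurableSet_cyl_inter N x₀ _))
    rw [measure_mono_null (Set.image_mono Set.inter_subset_left) h0, eq_comm, mul_eq_zero,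
      ENNReal.coe_eq_zero, or_iff_right
        (Finset.prod_ne_zero_iff.2 fun n _ => levelRatio_ne_zero hl.out _ _)] at h1
    rw [ae_iff]
    refine measure_mono_null (fun x hx => ?_) h1
    simp only [Set.mem_ofPred_eq, Classical.not_imp, not_not] at hx
    exact ⟨hx.2, hx.1⟩
  simpa [ae_iff] using this

lemma isNonsingular_prodRotation_zpow (hf : IsFast l p) (hp : IsCoprimeSeq p) (j : ℤ) :
    IsNonsingular (prodMeasure l p) (prodRotation p ^ j) := by
  have hm := measurable_prodRotation_zpow (p := p)
  refine ⟨hm j, by rw [prodRotation_zpow_symm]; exact hm _, ?_, ?_⟩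
  · have h := (absolutelyContinuous_map_symm hf hp j).map (hm j)
    rw [prodRotation_zpow_symm, Measure.map_map (hm _) (hm _)] at h
    have hid : ⇑(prodRotation p ^ j) ∘ ⇑(prodRotation p ^ (-j)) = id := by
      rw [← Equiv.Perm.coe_mul, ← zpow_add, add_neg_cancel, zpow_zero, Equiv.Perm.coe_one]
    rwa [hid, Measure.map_id] at h
  · have h := absolutelyContinuous_map_symm hf hp (-j)
    rwa [prodRotation_zpow_symm, neg_neg] at h

lemma ae_exists_rnRatio_eq_zpow (hf : IsFast l p) (hp : IsCoprimeSeq p) (j : ℤ) :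
    ∀ᵐ x ∂prodMeasure l p, ∃ z : ℤ, rnRatio (prodMeasure l p) (prodRotation p ^ j) x = l ^ z := by
  refine ae_of_forall_cyl (E := fun N => {x | ∀ n, N ≤ n → x n ∈ sameLevel l p j n})
    (ae_eventually_mem_sameLevel hf hp j) fun N x₀ => ?_
  have h := (scalesOn_cyl_inter (l := l) j N x₀ (sameLevel l p j) fun _ _ => subset_rfl).rnRatio_eq
    (isNonsingular_prodRotation_zpow hf hp j).2.1 (measurableSet_cyl_inter N x₀ _)
  choose z hz using fun n =>
    exists_levelRatio_eq_zpow (l := l) (x₀ n) ((finRotate (p n) ^ j) (x₀ n))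
  filter_upwards [h] with x hx hxB
  refine ⟨∑ n ∈ Finset.range N, z n, ?_⟩
  rw [hx hxB, Finset.prod_congr rfl fun n _ => hz n]
  have : ∀ s : Finset ℕ, ∏ n ∈ s, l ^ z n = l ^ ∑ n ∈ s, z n := by
    intro s
    classical
    induction s using Finset.induction_on with
    | empty => simp
    | insert a s ha ih => rw [Finset.prod_insert ha, Finset.sum_insert ha, ih, zpow_add₀ hl.out.ne']
  rw [this]
  push_cast
  rfl

lemma measure_cyl_eq_mul (k : ℕ) (a b : ∀ n, Fin (p n)) :
    prodMeasure l p (cyl k b) =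
      (∏ n ∈ Finset.range k, levelRatio l (p n) (a n) (b n) : ℝ≥0) *
        prodMeasure l p (cyl k a) := by
  rw [prodMeasure, cyl, cyl, Measure.infinitePi_pi _ fun n _ => measurableSet_singleton _,
    Measure.infinitePi_pi _ fun n _ => measurableSet_singleton _]
  push_cast
  rw [← Finset.prod_mul_distrib]
  exact Finset.prod_congr rfl fun n _ => levelMeasure_singleton_eq_mul hl.out _ _

/-- The densities of `A` in two depth-`k` cylinders differ by at most `2^{-k-1}`, written without
division. The power of `T` given by the Chinese remainder theorem scales by the ratio of the
cylinder masses, except on the part of `cyl k a` outside `tailY`. -/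
lemma measure_cyl_mul_le_of_invariant (hf : IsFast l p) (hp : IsCoprimeSeq p)
    {A : Set (∀ n, Fin (p n))} (hA : MeasurableSet A)
    (hinv : ∀ j : ℤ, (prodRotation p ^ j) ⁻¹' A =ᵐ[prodMeasure l p] A) (k : ℕ)
    (a b : ∀ n, Fin (p n)) :
    prodMeasure l p (A ∩ cyl k a) * prodMeasure l p (cyl k b) ≤
      prodMeasure l p (cyl k a) * prodMeasure l p (A ∩ cyl k b) +
        2⁻¹ ^ (k + 1) * prodMeasure l p (cyl k a) * prodMeasure l p (cyl k b) := by
  choose m hm using fun n => exists_finRotate_pow_eq (a n) (b n)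
  obtain ⟨j, hj, hjm⟩ := exists_lt_partialProd_modEq hp m k
  have hab : ∀ n < k, (finRotate (p n) ^ (j : ℤ)) (a n) = b n := fun n hn => by
    rw [zpow_natCast, finRotate_pow_eq_of_modEq (hjm n hn), hm n]
  have hmono := (strictMono_partialProd hp (hf.one_lt hp)).monotone
  have hs := scalesOn_cyl_inter (l := l) (j : ℤ) k a (setY p)
    fun n hn => setY_subset_sameLevel (hj.le.trans (hmono hn))
  rw [Finset.prod_congr rfl fun n hn => by rw [hab n (Finset.mem_range.1 hn)]] at hs
  set C := ∏ n ∈ Finset.range k, levelRatio l (p n) (a n) (b n)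
  have h1 := hs _ (Set.inter_subset_right (s := A)) (hA.inter (measurableSet_cyl_inter k a _))
  have h2 : prodMeasure l p ((prodRotation p ^ (j : ℤ)) ''
      (A ∩ (cyl k a ∩ {x | ∀ n, k ≤ n → x n ∈ setY p n}))) ≤ prodMeasure l p (A ∩ cyl k b) := by
    refine measure_mono_ae ?_
    filter_upwards [hinv (-j)] with y hy
    rintro ⟨x, hx, rfl⟩
    refine ⟨?_, mem_cyl.2 fun n hn => ?_⟩
    · have hy : (x ∈ A) = ((prodRotation p ^ (j : ℤ)) x ∈ A) := by
        have hy' : ((prodRotation p ^ (-(j : ℤ))) ((prodRotation p ^ (j : ℤ)) x) ∈ A) =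
          ((prodRotation p ^ (j : ℤ)) x ∈ A) := hy
        rwa [zpow_neg_apply_self] at hy'
      exact hy ▸ hx.1
    · rw [prodRotation_zpow_apply, mem_cyl.1 hx.2.1 n hn, hab n hn]
  have h3 : prodMeasure l p (A ∩ cyl k a) ≤
      prodMeasure l p (A ∩ (cyl k a ∩ {x | ∀ n, k ≤ n → x n ∈ setY p n})) +
        2⁻¹ ^ (k + 1) * prodMeasure l p (cyl k a) := by
    refine (measure_mono fun x hx => ?_).trans ((measure_union_le _ _).trans
      (add_le_add le_rfl (measure_pi_range_diff_tailY_le hf k fun n => {a n})))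
    by_cases hxt : x ∈ tailY p k
    · exact Or.inl ⟨hx.1, hx.2, hxt⟩
    · exact Or.inr ⟨hx.2, hxt⟩
  rw [h1] at h2
  calc _ ≤ (prodMeasure l p (A ∩ (cyl k a ∩ {x | ∀ n, k ≤ n → x n ∈ setY p n})) +
        2⁻¹ ^ (k + 1) * prodMeasure l p (cyl k a)) * prodMeasure l p (cyl k b) := by gcongr
    _ = prodMeasure l p (cyl k a) *
        (C * prodMeasure l p (A ∩ (cyl k a ∩ {x | ∀ n, k ≤ n → x n ∈ setY p n}))) +
        2⁻¹ ^ (k + 1) * prodMeasure l p (cyl k a) * prodMeasure l p (cyl k b) := by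
      rw [add_mul]
      congr 1
      rw [measure_cyl_eq_mul k a b]
      ring
    _ ≤ _ := by gcongr

lemma exists_forall_two_inv_pow_le {δ : ℝ≥0} (hδ : 0 < δ) :
    ∃ K, ∀ k, K ≤ k → (2⁻¹ : ℝ≥0∞) ^ (k + 1) ≤ δ := by
  obtain ⟨K, hK⟩ := ENNReal.exists_inv_two_pow_lt (a := (δ : ℝ≥0∞)) (by simpa using hδ.ne')
  refine ⟨K, fun k hk => le_trans ?_ hK.le⟩
  exact pow_le_pow_right_of_le_one' inv_two_le_one (by omega)

lemma measure_eq_zero_or_compl_of_invariant (hf : IsFast l p) (hp : IsCoprimeSeq p)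
    {A : Set (∀ n, Fin (p n))} (hA : MeasurableSet A)
    (hinv : ∀ j : ℤ, (prodRotation p ^ j) ⁻¹' A =ᵐ[prodMeasure l p] A) :
    prodMeasure l p A = 0 ∨ prodMeasure l p Aᶜ = 0 := by
  set μ := prodMeasure l p with hμ
  -- Summing over all target cylinders `b` replaces the density in `b` by the global density `μ A`.
  have h1 : ∀ k a, μ (A ∩ cyl k a) ≤ μ (cyl k a) * μ A + 2⁻¹ ^ (k + 1) * μ (cyl k a) := by
    intro k a
    have := measure_univ_le_of_cyl_le (α := μ (A ∩ cyl k a) • μ)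
      (β := μ (cyl k a) • μ.restrict A + (2⁻¹ ^ (k + 1) * μ (cyl k a)) • μ) (k := k) (fun b => by
        simp only [Measure.smul_apply, Measure.add_apply, smul_eq_mul,
          Measure.restrict_apply (measurableSet_cyl k b)]
        rw [Set.inter_comm (cyl k b) A]
        exact measure_cyl_mul_le_of_invariant hf hp hA hinv k a b)
    simpa only [Measure.smul_apply, Measure.add_apply, smul_eq_mul, Measure.restrict_apply_univ,
      measure_univ, mul_one] using this
  have : IsFiniteMeasure (μ A • μ) := Measure.smul_finite _ (measure_ne_top _ _)
  -- As `k` grows the error vanishes, so `μ` restricted to `A` is at most `μ A • μ`; at `A` itself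
  -- this reads `μ A ≤ (μ A)^2`.
  have h2 := le_of_cyl_le (α := μ.restrict A) (β := μ A • μ) (μ := μ) (fun δ hδ => by
    obtain ⟨K, hK⟩ := exists_forall_two_inv_pow_le hδ
    refine ⟨K, fun k hk x => ?_⟩
    rw [Measure.restrict_apply (measurableSet_cyl k x), Set.inter_comm, Measure.smul_apply,
      smul_eq_mul, mul_comm (μ A)]
    refine (h1 k x).trans ?_
    gcongr
    exact hK k hk) hA
  rw [Measure.restrict_apply_self, Measure.smul_apply, smul_eq_mul] at h2
  by_cases h0 : μ A = 0
  · exact Or.inl h0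
  · refine Or.inr ((prob_compl_eq_zero_iff hA).2 (le_antisymm prob_le_one ?_))
    exact (ENNReal.mul_le_mul_iff_right h0 (measure_ne_top _ _)).1 (by rwa [mul_one])

/-- A weak density theorem: otherwise `δ μ` would be dominated by `μ` restricted to `Aᶜ`, which
vanishes on `A`. -/
lemma exists_cyl_diff_lt {A : Set (∀ n, Fin (p n))} (hA : MeasurableSet A)
    (hpos : 0 < prodMeasure l p A) {δ : ℝ≥0} (hδ : 0 < δ) (K : ℕ) :
    ∃ k, K ≤ k ∧ ∃ a, prodMeasure l p (cyl k a \ A) < δ * prodMeasure l p (cyl k a) := by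
  by_contra! hcon
  have h := le_of_cyl_le (α := δ • prodMeasure l p) (β := (prodMeasure l p).restrict Aᶜ)
    (μ := prodMeasure l p) (fun ε _ => ⟨K, fun k hk x => by
      rw [Measure.restrict_apply (measurableSet_cyl k x), ← Set.sdiff_eq, Measure.smul_apply,
        ENNReal.smul_def, smul_eq_mul]
      exact (hcon k hk x).trans le_self_add⟩) hA
  rw [Measure.restrict_apply hA, Set.inter_compl_self, measure_empty, Measure.smul_apply,
    ENNReal.smul_def, smul_eq_mul] at h
  exact (ENNReal.mul_pos (by simpa using hδ.ne') hpos.ne').not_ge h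

end Dynamics

/-! ### Rigidity and type III -/

section Main

variable {l : ℝ≥0} {p : ℕ → ℕ}

lemma finRotate_pow_partialProd [∀ n, NeZero (p n)] {n k : ℕ} (hn : n < k) :
    finRotate (p n) ^ partialProd p k = 1 := by
  have : partialProd p k ≡ 0 [MOD p n] :=
    (Nat.modEq_zero_iff_dvd).2 (Finset.dvd_prod_of_mem p (Finset.mem_range.2 hn))
  rw [finRotate_pow_eq_of_modEq this, pow_zero]

lemma prodRotation_pow_preimage_restrict [∀ n, NeZero (p n)] {k K : ℕ} (hk : K ≤ k)
    (D : Set (∀ n : Finset.range K, Fin (p n))) :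
    (prodRotation p ^ partialProd p k) ⁻¹' ((Finset.range K).restrict ⁻¹' D) =
      (Finset.range K).restrict ⁻¹' D := by
  rw [← Set.preimage_comp]
  congr 1
  ext x n
  have := finRotate_pow_partialProd (p := p) ((Finset.mem_range.1 n.2).trans_le hk)
  rw [prodRotation_pow]
  change ((finRotate (p n) ^ partialProd p k) (x n) : ℕ) = x n
  rw [this, Equiv.Perm.one_apply]

variable [∀ n, NeZero (p n)] [hl : Fact (0 < l)]

lemma scalesOn_tailY (hf : IsFast l p) (hp : IsCoprimeSeq p) (k : ℕ) :
    ScalesOn (prodMeasure l p) (prodRotation p ^ partialProd p k) 1 (tailY p k) := by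
  have h := scalesOn_prodRotation (l := l) (p := p) (partialProd p k : ℤ) (fun _ => 1) 0
    (fun _ _ => rfl) (fun n => if n < k then Set.univ else setY p n) (fun n x hx => by
      split_ifs at hx with hn
      · rw [zpow_natCast, finRotate_pow_partialProd hn]
        exact levelRatio_eq_one hl.out rfl
      · exact levelRatio_eq_one hl.out (setY_subset_sameLevel
          ((strictMono_partialProd hp (hf.one_lt hp)).monotone (not_lt.1 hn)) hx))
  rw [zpow_natCast, Finset.prod_range_zero] at h
  refine h.mono fun x hx n _ => ?_
  beta_reduce
  split_ifs with hn
  · trivial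
  · exact hx n (not_lt.1 hn)

lemma isNonsingular_prodRotation_pow (hf : IsFast l p) (hp : IsCoprimeSeq p) (j : ℕ) :
    IsNonsingular (prodMeasure l p) (prodRotation p ^ j) := by
  rw [← zpow_natCast]
  exact isNonsingular_prodRotation_zpow hf hp j

lemma measure_pow_preimage_le (hf : IsFast l p) (hp : IsCoprimeSeq p) (k : ℕ)
    {D : Set (∀ n, Fin (p n))} (hD : MeasurableSet D) :
    prodMeasure l p ((prodRotation p ^ partialProd p k) ⁻¹' D) ≤
      prodMeasure l p D + 2⁻¹ ^ (k + 1) := by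
  set γ := prodRotation p ^ partialProd p k
  have hγ := (isNonsingular_prodRotation_pow hf hp (partialProd p k)).1
  have h1 := scalesOn_tailY hf hp k (γ ⁻¹' D ∩ tailY p k) Set.inter_subset_right
    ((hγ hD).inter (measurableSet_tailY k))
  rw [ENNReal.coe_one, one_mul] at h1
  calc prodMeasure l p (γ ⁻¹' D)
      ≤ prodMeasure l p (γ ⁻¹' D ∩ tailY p k) + prodMeasure l p (tailY p k)ᶜ := by
        refine (measure_mono fun x hx => ?_).trans (measure_union_le _ _)
        by_cases hxt : x ∈ tailY p k
        · exact Or.inl ⟨hx, hxt⟩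
        · exact Or.inr hxt
    _ ≤ prodMeasure l p D + 2⁻¹ ^ (k + 1) := by
        rw [← h1]
        refine add_le_add (measure_mono ?_) (measure_compl_tailY_le hf k)
        rintro _ ⟨x, hx, rfl⟩
        exact hx.1

/-- A cylinder set is fixed exactly by `T^{P_k}` for large `k`. The error of approximating `A` by it
is carried along with a loss of at most `2^{-k-1}`. -/
lemma tendsto_measure_symmDiff_preimage (hf : IsFast l p) (hp : IsCoprimeSeq p)
    {A : Set (∀ n, Fin (p n))} (hA : MeasurableSet A) :
    Tendsto (fun k => prodMeasure l p
      (symmDiff ((prodRotation p ^ partialProd p k) ⁻¹' A) A)) atTop (𝓝 0) := by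
  rw [ENNReal.tendsto_nhds_zero]
  intro ε hε
  have hε3 : ε / 3 ≠ 0 := (ENNReal.div_pos hε.ne' (by norm_num)).ne'
  obtain ⟨C, hC, hCA⟩ := exists_measurableCylinder_symmDiff_lt (prodMeasure l p) hA hε3
  obtain ⟨K, hK⟩ := exists_range_restrict_preimage hC
  obtain ⟨D, hD⟩ := hK K le_rfl
  have hlim : Tendsto (fun k : ℕ => (2⁻¹ : ℝ≥0∞) ^ (k + 1)) atTop (𝓝 0) :=
    (ENNReal.tendsto_pow_atTop_nhds_zero_of_lt_one ENNReal.one_half_lt_one).comp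
      (tendsto_add_atTop_nat 1)
  have hCm : MeasurableSet C := .of_mem_measurableCylinders hC
  filter_upwards [eventually_ge_atTop K, ENNReal.tendsto_nhds_zero.1 hlim _ hε3.bot_lt]
    with k hk hk2
  set γ := prodRotation p ^ partialProd p k
  have hγC : γ ⁻¹' C = C := by
    rw [hD]
    exact prodRotation_pow_preimage_restrict hk D
  have hsub : symmDiff (γ ⁻¹' A) A ⊆ γ ⁻¹' (symmDiff C A) ∪ symmDiff C A := by
    have h1 : γ ⁻¹' (symmDiff C A) = symmDiff C (γ ⁻¹' A) := by
      conv_rhs => rw [← hγC]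
      rfl
    rw [h1, symmDiff_comm C (γ ⁻¹' A)]
    exact symmDiff_triangle _ _ _
  calc prodMeasure l p (symmDiff (γ ⁻¹' A) A)
      ≤ prodMeasure l p (γ ⁻¹' (symmDiff C A)) + prodMeasure l p (symmDiff C A) :=
        (measure_mono hsub).trans (measure_union_le _ _)
    _ ≤ (prodMeasure l p (symmDiff C A) + 2⁻¹ ^ (k + 1)) + prodMeasure l p (symmDiff C A) := by
        gcongr
        exact measure_pow_preimage_le hf hp k (hCm.symmDiff hA)
    _ ≤ ε / 3 + ε / 3 + ε / 3 := by gcongr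
    _ = ε := ENNReal.add_thirds ε

/-- The integrand vanishes on `E`; off `E` it is at most the ratio plus `1`, and `Eᶜ` has the same
mass under both probability measures. -/
lemma integral_abs_rnRatio_sub_one_le {Y : Type*} [MeasurableSpace Y] {μ : Measure Y}
    [IsProbabilityMeasure μ] {γ : Equiv.Perm Y} (hγ : Measurable γ.symm) {E : Set Y}
    (hE : MeasurableSet E) (h : ScalesOn μ γ 1 E) :
    ∫ y, |rnRatio μ γ y - 1| ∂μ ≤ 2 * μ.real Eᶜ := by
  have : IsProbabilityMeasure (μ.map γ.symm) := Measure.isProbabilityMeasure_map hγ.aemeasurable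
  have hint : Integrable (rnRatio μ γ) μ := Measure.integrable_toReal_rnDeriv
  have hint' : Integrable (fun y => |rnRatio μ γ y - 1|) μ :=
    (hint.sub (integrable_const 1)).abs
  have h0 : ∫ y in E, |rnRatio μ γ y - 1| ∂μ = 0 := by
    rw [setIntegral_congr_ae (g := fun _ => (0 : ℝ)) hE, integral_zero]
    filter_upwards [h.rnRatio_eq hγ hE] with y hy hyE
    simp [hy hyE]
  have hν : (μ.map γ.symm).real Eᶜ = μ.real Eᶜ := by
    rw [probReal_compl_eq_one_sub hE, probReal_compl_eq_one_sub hE, measureReal_def,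
      measureReal_def, Measure.map_apply hγ hE, ← Equiv.image_eq_preimage_symm,
      h E subset_rfl hE, ENNReal.coe_one, one_mul]
  rw [← integral_add_compl hE hint', h0, zero_add]
  calc ∫ y in Eᶜ, |rnRatio μ γ y - 1| ∂μ
      ≤ ∫ y in Eᶜ, (rnRatio μ γ y + 1) ∂μ := by
        refine setIntegral_mono hint'.integrableOn
          (hint.add (integrable_const 1)).integrableOn fun y => ?_
        have : 0 ≤ rnRatio μ γ y := ENNReal.toReal_nonneg
        exact abs_sub_le_iff.2 ⟨by linarith, by linarith⟩
    _ = ∫ y in Eᶜ, rnRatio μ γ y ∂μ + μ.real Eᶜ := by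
        rw [integral_add hint.integrableOn (integrable_const 1)]
        simp
    _ ≤ 2 * μ.real Eᶜ := by
        have : ∫ y in Eᶜ, rnRatio μ γ y ∂μ ≤ (μ.map γ.symm).real Eᶜ :=
          Measure.setIntegral_toReal_rnDeriv_le (measure_ne_top _ _)
        linarith

theorem isRigid_prodRotation (hf : IsFast l p) (hp : IsCoprimeSeq p) :
    IsRigid (prodMeasure l p) (prodRotation p) := by
  refine ⟨partialProd p, strictMono_partialProd hp (hf.one_lt hp),
    fun A hA => tendsto_measure_symmDiff_preimage hf hp hA, ?_⟩
  have hlim : Tendsto (fun k : ℕ => (2⁻¹ : ℝ) ^ k) atTop (𝓝 0) :=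
    tendsto_pow_atTop_nhds_zero_of_lt_one (by norm_num) (by norm_num)
  refine squeeze_zero (fun k => integral_nonneg fun y => abs_nonneg _) (fun k => ?_) hlim
  refine (integral_abs_rnRatio_sub_one_le (isNonsingular_prodRotation_pow hf hp _).2.1
    (measurableSet_tailY k) (scalesOn_tailY hf hp k)).trans ?_
  have h : (prodMeasure l p).real (tailY p k)ᶜ ≤ (2⁻¹ : ℝ) ^ (k + 1) := by
    have := ENNReal.toReal_mono (by simp) (measure_compl_tailY_le hf k)
    simpa [measureReal_def] using this
  rw [pow_succ] at h
  linarith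

lemma IsFast.le_measure_setZ (hf : IsFast l p) (hl1 : l < 1) (n : ℕ) :
    4⁻¹ ≤ levelMeasure l (p n) (setZ p n) := by
  have h := hf.measure_setZ n
  have h4 : (1 / 4 : ℝ) ≤ 1 / (2 * ((l : ℝ) + 1)) := by
    have : (l : ℝ) < 1 := by exact_mod_cast hl1
    have : (0 : ℝ) ≤ l := l.2
    exact one_div_le_one_div_of_le (by positivity) (by linarith)
  rw [← ENNReal.ofReal_toReal (measure_ne_top (levelMeasure l (p n)) (setZ p n))]
  refine le_trans (le_of_eq ?_) (ENNReal.ofReal_le_ofReal (h4.trans h.le))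
  rw [one_div, ENNReal.ofReal_inv_of_pos (by norm_num), ENNReal.ofReal_ofNat]

/-- The points that agree with `a` in the first `k` coordinates, lie in `Z_k`, and lie in `Y_n` for
all `n > k`. -/
def lowBox (p : ℕ → ℕ) (k : ℕ) (a : ∀ n, Fin (p n)) : Set (∀ n, Fin (p n)) :=
  Set.univ.pi fun n => if n < k then {a n} else if n = k then setZ p n else setY p n

/-- The constant is `4 · 2`: requiring `Z_k` keeps at least a quarter of the cylinder, and the later
`Y_n` keep at least half of what remains. -/
lemma measure_cyl_le_measure_lowBox (hf : IsFast l p) (hl1 : l < 1) (k : ℕ)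
    (a : ∀ n, Fin (p n)) :
    prodMeasure l p (cyl k a) ≤ 8 * prodMeasure l p (lowBox p k a) := by
  set u : ∀ n, Set (Fin (p n)) := fun n => if n < k then {a n} else setZ p n
  set Q := Set.pi (Finset.range (k + 1) : Set ℕ) u
  have hQ : prodMeasure l p Q =
      prodMeasure l p (cyl k a) * levelMeasure l (p k) (setZ p k) := by
    rw [prodMeasure, cyl, Measure.infinitePi_pi _ fun n _ => (Set.toFinite _).measurableSet,
      Measure.infinitePi_pi _ fun n _ => (Set.toFinite _).measurableSet, Finset.prod_range_succ]
    congr 1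
    · exact Finset.prod_congr rfl fun n hn => by simp [u, Finset.mem_range.1 hn]
    · simp [u]
  have h1 : prodMeasure l p (cyl k a) ≤ 4 * prodMeasure l p Q := by
    rw [hQ]
    calc prodMeasure l p (cyl k a) = 4 * (prodMeasure l p (cyl k a) * 4⁻¹) := by
          rw [mul_comm, mul_assoc, ENNReal.inv_mul_cancel (by norm_num) (by norm_num), mul_one]
      _ ≤ _ := by
          gcongr
          exact hf.le_measure_setZ hl1 k
  have h2 : prodMeasure l p Q ≤ prodMeasure l p (lowBox p k a) + 2⁻¹ * prodMeasure l p Q := by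
    refine (measure_mono fun x hx => ?_).trans ((measure_union_le _ _).trans
      (add_le_add le_rfl ((measure_pi_range_diff_tailY_le hf (k + 1) u).trans ?_)))
    · by_cases hxt : x ∈ tailY p (k + 1)
      · refine Or.inl fun n _ => ?_
        beta_reduce
        split_ifs with hn hn'
        · simpa [u, hn] using hx n (by simp; omega)
        · simpa [u, hn] using hx n (by simp; omega)
        · exact hxt n (by omega)
      · exact Or.inr ⟨hx, hxt⟩
    · gcongr
      calc (2⁻¹ : ℝ≥0∞) ^ (k + 1 + 1) ≤ 2⁻¹ ^ 1 :=
            pow_le_pow_right_of_le_one' inv_two_le_one (by omega)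
        _ = 2⁻¹ := pow_one _
  have h3 : prodMeasure l p Q ≤ 2 * prodMeasure l p (lowBox p k a) := by
    refine (ENNReal.add_le_add_iff_right (measure_ne_top (prodMeasure l p) Q)).1 ?_
    calc prodMeasure l p Q + prodMeasure l p Q = 2 * prodMeasure l p Q := (two_mul _).symm
      _ ≤ 2 * (prodMeasure l p (lowBox p k a) + 2⁻¹ * prodMeasure l p Q) := by gcongr
      _ = _ := by
        rw [mul_add, ← mul_assoc 2 2⁻¹, ENNReal.mul_inv_cancel (by norm_num) (by norm_num),
          one_mul]
  calc _ ≤ 4 * (2 * prodMeasure l p (lowBox p k a)) := h1.trans (by gcongr)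
    _ = _ := by rw [← mul_assoc]; norm_num

/-- Coordinates below `k` do not move, coordinate `k` goes from the lower level to the upper one and
contributes `l`, and the later ones keep their level because `j < P_{k+1}`. -/
lemma exists_scalesOn_lowBox (hf : IsFast l p) (hp : IsCoprimeSeq p) (k : ℕ)
    (a : ∀ n, Fin (p n)) : ∃ γ ∈ Subgroup.zpowers (prodRotation p),
      ScalesOn (prodMeasure l p) γ l (lowBox p k a) ∧ γ '' lowBox p k a ⊆ cyl k a := by
  obtain ⟨j, hj, hjm⟩ := exists_lt_partialProd_modEq hp (fun n => if n = k then p k / 2 else 0)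
    (k + 1)
  have hmono := (strictMono_partialProd hp (hf.one_lt hp)).monotone
  have hlow : ∀ n < k, finRotate (p n) ^ j = 1 := fun n hn => by
    have := hjm n (by omega)
    rw [if_neg hn.ne] at this
    rw [finRotate_pow_eq_of_modEq this, pow_zero]
  refine ⟨prodRotation p ^ (j : ℤ), Subgroup.zpow_mem_zpowers _ _, ?_, ?_⟩
  · have h := scalesOn_prodRotation (l := l) (p := p) (j : ℤ) (fun n => if n = k then l else 1)
      (k + 1) (fun n hn => if_neg (by omega))
      (fun n => if n < k then {a n} else if n = k then setZ p n else setY p n)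
      (fun n x hx => by
        split_ifs at hx with hn hn'
        · rw [if_neg hn.ne, zpow_natCast, hlow n hn]
          exact levelRatio_eq_one hl.out rfl
        · subst hn'
          have := hjm n (by omega)
          rw [if_pos rfl] at this
          rw [if_pos rfl, zpow_natCast, finRotate_pow_eq_of_modEq this]
          exact levelRatio_finRotate_half (partialProd_pos hp n) hx
        · rw [if_neg hn']
          exact levelRatio_eq_one hl.out (setY_subset_sameLevel
            (hj.le.trans (hmono (by omega))) hx))
    rwa [Finset.prod_ite_eq' , if_pos (by simp)] at h
  · rintro _ ⟨x, hx, rfl⟩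
    refine mem_cyl.2 fun n hn => ?_
    have := hx n (Set.mem_univ n)
    beta_reduce at this
    rw [if_pos hn] at this
    rw [prodRotation_zpow_apply, zpow_natCast, hlow n hn]
    exact this

lemma isScalingValue_prodRotation (hf : IsFast l p) (hp : IsCoprimeSeq p) (hl1 : l < 1) :
    IsScalingValue (prodMeasure l p) (Subgroup.zpowers (prodRotation p)) l := by
  intro A hA hpos
  have hl0 : 0 < l := hl.out
  -- With `b`, `d` the masses of the cylinder and of its part outside `A`, a null intersection would
  -- give `l b ≤ 8 (l d + d) ≤ 16 d`; the threshold `l / 16` excludes this.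
  obtain ⟨k, -, a, hka⟩ := exists_cyl_diff_lt hA hpos (δ := l / 16) (by positivity) 0
  obtain ⟨γ, hγ, hs, himg⟩ := exists_scalesOn_lowBox (l := l) hf hp k a
  have hγm : Measurable γ := by
    obtain ⟨j, rfl⟩ := Subgroup.mem_zpowers_iff.1 hγ
    exact measurable_prodRotation_zpow j
  set R := lowBox p k a
  have hR : MeasurableSet R := MeasurableSet.univ_pi fun n => (Set.toFinite _).measurableSet
  have hRcyl : R ⊆ cyl k a := fun x hx => mem_cyl.2 fun n hn => by
    simpa [hn] using hx n (Set.mem_univ n)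
  refine ⟨R ∩ A ∩ γ ⁻¹' A, fun x hx => hx.1.2, (hR.inter hA).inter (hγm hA), ?_, γ, hγ, ?_,
    hs.mono fun x hx => hx.1.1⟩
  · rw [pos_iff_ne_zero]
    intro h0
    set b := prodMeasure l p (cyl k a)
    set d := prodMeasure l p (cyl k a \ A)
    have h1 : prodMeasure l p R ≤ d + prodMeasure l p (R \ γ ⁻¹' A) := by
      calc prodMeasure l p R ≤ prodMeasure l p ((R \ A) ∪ (R \ γ ⁻¹' A) ∪ (R ∩ A ∩ γ ⁻¹' A)) := by
            refine measure_mono fun x hx => ?_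
            by_cases h1 : x ∈ A
            · by_cases h2 : x ∈ γ ⁻¹' A
              · exact Or.inr ⟨⟨hx, h1⟩, h2⟩
              · exact Or.inl (Or.inr ⟨hx, h2⟩)
            · exact Or.inl (Or.inl ⟨hx, h1⟩)
        _ ≤ prodMeasure l p (R \ A) + prodMeasure l p (R \ γ ⁻¹' A) + 0 := by
            rw [← h0]
            exact (measure_union_le _ _).trans (add_le_add (measure_union_le _ _) le_rfl)
        _ ≤ _ := by
            rw [add_zero]
            gcongr
            exact measure_mono (Set.sdiff_subset_sdiff_left hRcyl)
    have h2 : l * prodMeasure l p (R \ γ ⁻¹' A) ≤ d := by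
      rw [← hs _ Set.sdiff_subset (hR.diff (hγm hA))]
      refine measure_mono ?_
      rintro _ ⟨x, hx, rfl⟩
      exact ⟨himg ⟨x, hx.1, rfl⟩, hx.2⟩
    have h3 : l * b < l * b := by
      calc l * b ≤ l * (8 * (d + prodMeasure l p (R \ γ ⁻¹' A))) := by
            gcongr
            exact (measure_cyl_le_measure_lowBox hf hl1 k a).trans (by gcongr)
        _ = 8 * (l * d + l * prodMeasure l p (R \ γ ⁻¹' A)) := by ring
        _ ≤ 8 * (1 * d + d) := by
            gcongr
            exact_mod_cast hl1.le
        _ = 16 * d := by ring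
        _ < 16 * ((l / 16 : ℝ≥0) * b) :=
            (ENNReal.mul_lt_mul_iff_right (by norm_num) (by norm_num)).2 hka
        _ = l * b := by
            have : (16 : ℝ≥0) * (l / 16) = l := by field_simp
            rw [← mul_assoc]
            congr 1
            exact_mod_cast this
    exact lt_irrefl _ h3
  · rintro _ ⟨x, hx, rfl⟩
    exact hx.2

theorem isKriegerTypeIII_prodRotation (hf : IsFast l p) (hp : IsCoprimeSeq p) (hl1 : l < 1) :
    IsKriegerTypeIII l (prodMeasure l p) (Subgroup.zpowers (prodRotation p)) := by
  have hl0 : 0 < l := hl.out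
  have hΓ : ∀ γ ∈ Subgroup.zpowers (prodRotation p), IsNonsingular (prodMeasure l p) γ := by
    intro γ hγ
    obtain ⟨j, rfl⟩ := Subgroup.mem_zpowers_iff.1 hγ
    exact isNonsingular_prodRotation_zpow hf hp j
  refine ⟨by exact_mod_cast hl0, by exact_mod_cast hl1, ⟨?_, hΓ, ?_⟩, ?_⟩
  · exact inferInstance
  · intro A hA hinv
    exact measure_eq_zero_or_compl_of_invariant hf hp hA fun j =>
      hinv _ (Subgroup.zpow_mem_zpowers _ j)
  · have hlog : Real.log l ≠ 0 := (Real.log_neg (by exact_mod_cast hl0) (by exact_mod_cast hl1)).ne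
    refine Set.Subset.antisymm (fun g hg => ?_) ?_
    · by_contra hcon
      -- The lattice is closed, so a value outside it has a neighbourhood that the cocycle almost
      -- surely never visits.
      have hclosed : IsClosed (Set.range fun n : ℤ => (n : ℝ) * Real.log l) :=
        ((Homeomorph.mulRight₀ _ hlog).isClosedEmbedding.comp
          Int.isClosedEmbedding_coe_real).isClosed_range
      obtain ⟨B, -, -, hB, γ, hγ, -, hU⟩ := hg Set.univ MeasurableSet.univ (by simp) _
        (hclosed.isOpen_compl.mem_nhds hcon)
      obtain ⟨j, rfl⟩ := Subgroup.mem_zpowers_iff.1 hγ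
      refine hB.ne' (measure_mono_null (fun y hy => ?_)
        (ae_iff.1 (ae_exists_rnRatio_eq_zpow hf hp j)))
      rintro ⟨z, hz⟩
      exact hU y hy ⟨z, by rw [logRN, hz, Real.log_zpow]⟩
    · rintro _ ⟨n, rfl⟩
      have := ((isScalingValue_prodRotation hf hp hl1).zpow hΓ hl0.ne' n).isEssentialValue hΓ
      rwa [NNReal.coe_zpow, Real.log_zpow] at this

end Main

/-! ### Finite type of the factors, through normalised counting measure -/

section FiniteType

lemma absolutelyContinuous_of_singleton_ne_zero {Y : Type*} [MeasurableSpace Y]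
    {μ ν : Measure Y} (h : ∀ y, ν {y} ≠ 0) : μ ≪ ν := by
  intro S hS
  have : S = ∅ := by
    by_contra hne
    obtain ⟨y, hy⟩ := Set.nonempty_iff_ne_empty.2 hne
    exact h y (measure_mono_null (by simpa using hy) hS)
  rw [this, measure_empty]

lemma map_perm_singleton {Y : Type*} [MeasurableSpace Y] [Countable Y]
    [MeasurableSingletonClass Y] (μ : Measure Y) (γ : Equiv.Perm Y) (y : Y) :
    μ.map γ {y} = μ {γ.symm y} := by
  rw [Measure.map_apply (measurable_of_countable _) (measurableSet_singleton y)]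
  congr 1
  ext z
  simp [Equiv.eq_symm_apply]

lemma isFiniteType_levelMeasure {l : ℝ≥0} (hl : 0 < l) (p : ℕ) [NeZero p] :
    IsFiniteType (levelMeasure l p) (finRotate p) := by
  have hpos : ∀ x, levelMeasure l p {x} ≠ 0 := fun x => (levelMeasure_singleton_pos hl x).ne'
  have hu : ∀ x : Fin p, ((p : ℝ≥0∞)⁻¹ • (Measure.count : Measure (Fin p))) {x} = (p : ℝ≥0∞)⁻¹ :=
    fun x => by simp
  refine ⟨⟨measurable_of_countable _, measurable_of_countable _,
    absolutelyContinuous_of_singleton_ne_zero hpos,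
    absolutelyContinuous_of_singleton_ne_zero fun x => by
      rw [map_perm_singleton]
      exact hpos _⟩, (p : ℝ≥0∞)⁻¹ • Measure.count, ⟨?_⟩,
    absolutelyContinuous_of_singleton_ne_zero hpos,
    absolutelyContinuous_of_singleton_ne_zero fun x => by rw [hu]; simp,
    Measure.ext_of_singleton fun x => by rw [map_perm_singleton, hu, hu]⟩
  have hp : (p : ℝ≥0∞) ≠ 0 := by exact_mod_cast NeZero.ne p
  simp [Measure.count_univ, ENNReal.inv_mul_cancel hp]

end FiniteType

/-! ### Quantitative estimates for the two-level measure -/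

section Growth

variable {l : ℝ≥0} {p : ℕ}

lemma levelWeight_le_one (hl1 : l < 1) (x : Fin p) : levelWeight l p x ≤ 1 := by
  unfold levelWeight
  split_ifs
  · exact le_rfl
  · exact_mod_cast hl1.le

lemma le_levelWeight (hl1 : l < 1) (x : Fin p) : (l : ℝ) ≤ levelWeight l p x := by
  unfold levelWeight
  split_ifs
  · exact_mod_cast hl1.le
  · exact le_rfl

lemma mul_le_sum_levelWeight (hl1 : l < 1) : (l : ℝ) * p ≤ ∑ x : Fin p, levelWeight l p x := by
  have := Finset.card_nsmul_le_sum (Finset.univ : Finset (Fin p)) (fun x => levelWeight l p x) l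
    fun x _ => le_levelWeight hl1 x
  rw [Finset.card_univ, Fintype.card_fin, nsmul_eq_mul] at this
  linarith

lemma sum_levelWeight_le (hl1 : l < 1) :
    ∑ x : Fin p, levelWeight l p x ≤ (1 + l) * (p / 2) + 1 := by
  classical
  have hw : ∀ x : Fin p, levelWeight l p x =
      l + (1 - l) * (if (x : ℕ) < p / 2 + 1 then 1 else 0) := by
    intro x
    have hiff : (((x : ℕ) : ℝ) ≤ (p : ℝ) / 2) ↔ (x : ℕ) < p / 2 + 1 := by
      rw [le_div_iff₀ (by norm_num : (0 : ℝ) < 2), Nat.lt_succ_iff,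
        Nat.le_div_iff_mul_le (by norm_num)]
      exact_mod_cast Iff.rfl
    unfold levelWeight
    simp only [hiff]
    split_ifs <;> ring
  have hcard : (Finset.univ.filter fun x : Fin p => (x : ℕ) < p / 2 + 1).card ≤ p / 2 + 1 := by
    refine (Finset.card_le_card_of_injOn (fun x : Fin p => (x : ℕ)) (t := Finset.range (p / 2 + 1))
      (fun x hx => ?_) (fun x _ y _ h => Fin.ext h)).trans_eq (Finset.card_range _)
    simpa using hx
  have hcard' : ((Finset.univ.filter fun x : Fin p => (x : ℕ) < p / 2 + 1).card : ℝ) ≤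
      p / 2 + 1 := by
    refine (Nat.cast_le.2 hcard).trans ?_
    push_cast
    gcongr
    exact Nat.cast_div_le
  have hl' : (l : ℝ) < 1 := by exact_mod_cast hl1
  have hl0 : (0 : ℝ) ≤ l := l.2
  rw [Finset.sum_congr rfl fun x _ => hw x, Finset.sum_add_distrib, ← Finset.mul_sum,
    Finset.sum_boole, Finset.sum_const, Finset.card_univ, Fintype.card_fin, nsmul_eq_mul]
  nlinarith

variable [NeZero p]

/-- One step changes the level only when it crosses the midpoint, from `p / 2`, or wraps around,
from `p - 1`. -/
lemma card_levelWeight_ne_le :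
    (Finset.univ.filter fun x : Fin p =>
      levelWeight l p (finRotate p x) ≠ levelWeight l p x).card ≤ 2 := by
  refine (Finset.card_le_card_of_injOn (fun x : Fin p => (x : ℕ)) (t := {p / 2, p - 1})
    (fun x hx => ?_) (fun x _ y _ h => Fin.ext h)).trans Finset.card_le_two
  simp only [Finset.coe_filter, Finset.mem_univ, true_and, Set.mem_ofPred_eq] at hx
  simp only [Finset.coe_insert, Finset.coe_singleton, Set.mem_insert_iff, Set.mem_singleton_iff]
  by_contra! hcon
  have hxp := x.isLt
  have hval : ((finRotate p x : Fin p) : ℕ) = x + 1 := by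
    have := finRotate_pow_val 1 x
    rwa [pow_one, Nat.mod_eq_of_lt (by omega)] at this
  refine hx ?_
  unfold levelWeight
  rw [hval]
  rcases lt_or_gt_of_ne hcon.1 with h | h
  · have h1 : (2 : ℝ) * ((x : ℕ) + 1) ≤ p := by
      exact_mod_cast (by omega : 2 * ((x : ℕ) + 1) ≤ p)
    rw [if_pos (by push_cast; linarith), if_pos (by linarith)]
  · have h1 : (p : ℝ) < 2 * (x : ℕ) := by
      exact_mod_cast (by omega : p < 2 * (x : ℕ))
    rw [if_neg (by push_cast; linarith), if_neg (by linarith)]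

variable [hl : Fact (0 < l)]

lemma levelMeasure_real_coe (S : Finset (Fin p)) : (levelMeasure l p).real (S : Set (Fin p)) =
    (∑ x ∈ S, levelWeight l p x) / ∑ x : Fin p, levelWeight l p x := by
  rw [← sum_measureReal_singleton, Finset.sum_div]
  refine Finset.sum_congr rfl fun x _ => ?_
  rw [measureReal_def, levelMeasure_singleton, ENNReal.toReal_ofReal
    (div_nonneg (levelWeight_pos hl.out x).le (sum_levelWeight_pos hl.out).le)]

lemma levelMeasure_real_coe_le (hl1 : l < 1) (S : Finset (Fin p)) :
    (levelMeasure l p).real (S : Set (Fin p)) ≤ S.card / (l * p) := by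
  have hl0 : (0 : ℝ) < l := by exact_mod_cast hl.out
  have hp0 : (0 : ℝ) < p := by exact_mod_cast NeZero.pos p
  rw [levelMeasure_real_coe]
  refine div_le_div₀ (Nat.cast_nonneg _) ?_ (by positivity) (mul_le_sum_levelWeight hl1)
  simpa using Finset.sum_le_card_nsmul S (fun x => levelWeight l p x) 1
    fun x _ => levelWeight_le_one hl1 x

/-- The squared Hellinger distance is at most the mass of the set where two measures differ. -/
lemma hellingerSq_le {Y : Type*} [MeasurableSpace Y] [Finite Y] [MeasurableSingletonClass Y]
    {γ δ : Measure Y} [IsFiniteMeasure γ] [IsFiniteMeasure δ] {B : Set Y}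
    (h : ∀ y ∉ B, γ {y} = δ {y}) : hellingerSq γ δ ≤ (1 / 2) * (δ.real B + γ.real B) := by
  have hB : MeasurableSet B := B.toFinite.measurableSet
  have hres : γ.restrict Bᶜ = δ.restrict Bᶜ := by
    refine Measure.ext_of_singleton fun y => ?_
    rw [Measure.restrict_apply (measurableSet_singleton y),
      Measure.restrict_apply (measurableSet_singleton y)]
    by_cases hy : y ∈ B
    · rw [Set.singleton_inter_eq_empty.2 (by simpa using hy), measure_empty, measure_empty]
    · rw [Set.inter_eq_self_of_subset_left (by simpa using hy), h y hy]
  have hone : ∀ᵐ y ∂δ, y ∈ Bᶜ → γ.rnDeriv δ y = 1 := by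
    have h1 := Measure.rnDeriv_restrict γ δ hB.compl
    rw [hres] at h1
    filter_upwards [h1, Measure.rnDeriv_restrict_self δ hB.compl] with y h1 h2 hy
    rw [h2, Set.indicator_of_mem hy, Set.indicator_of_mem hy] at h1
    exact h1.symm
  have hint : ∀ f : Y → ℝ, Integrable f δ := fun f => Integrable.of_finite
  unfold hellingerSq
  refine mul_le_mul_of_nonneg_left ?_ (by norm_num)
  rw [← integral_add_compl hB (hint _), setIntegral_congr_ae (s := Bᶜ) (g := fun _ => (0 : ℝ))
    hB.compl (by filter_upwards [hone] with y hy hyB; simp [hy hyB]), integral_zero, add_zero]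
  calc ∫ y in B, (1 - Real.sqrt (γ.rnDeriv δ y).toReal) ^ 2 ∂δ
      ≤ ∫ y in B, (1 + (γ.rnDeriv δ y).toReal) ∂δ := by
        refine setIntegral_mono (hint _).integrableOn (hint _).integrableOn fun y => ?_
        have h1 := Real.sq_sqrt (ENNReal.toReal_nonneg (a := γ.rnDeriv δ y))
        have h2 := Real.sqrt_nonneg (γ.rnDeriv δ y).toReal
        beta_reduce
        nlinarith
    _ = δ.real B + ∫ y in B, (γ.rnDeriv δ y).toReal ∂δ := by
        rw [integral_add (hint _).integrableOn (hint _).integrableOn]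
        simp
    _ ≤ δ.real B + γ.real B := by
        gcongr
        exact Measure.setIntegral_toReal_rnDeriv_le (measure_ne_top _ _)

lemma hellingerSq_levelMeasure_le (hl1 : l < 1) :
    hellingerSq (levelMeasure l p) ((levelMeasure l p).map (finRotate p)) ≤ 2 / (l * p) := by
  classical
  have hl0 : (0 : ℝ) < l := by exact_mod_cast hl.out
  have hp0 : (0 : ℝ) < p := by exact_mod_cast NeZero.pos p
  set S := Finset.univ.filter fun x : Fin p => levelWeight l p (finRotate p x) ≠ levelWeight l p x
  have hS : S.card ≤ 2 := card_levelWeight_ne_le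
  have hbound : ∀ F : Finset (Fin p), F.card ≤ 2 →
      (levelMeasure l p).real (F : Set (Fin p)) ≤ 2 / (l * p) := fun F hF =>
    (levelMeasure_real_coe_le hl1 F).trans (by gcongr; exact_mod_cast hF)
  -- The measures are compared at `T x`, where the push-forward has the mass of `x`; the bad set is
  -- therefore the image of `S`.
  have h := hellingerSq_le (γ := levelMeasure l p) (δ := (levelMeasure l p).map (finRotate p))
    (B := ((S.map (finRotate p).toEmbedding : Finset (Fin p)) : Set (Fin p))) (fun y hy => by
      obtain ⟨x, rfl⟩ := (finRotate p).surjective y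
      have hx : levelWeight l p (finRotate p x) = levelWeight l p x := by
        by_contra hne
        exact hy (by simpa [S] using hne)
      rw [map_perm_singleton, Equiv.symm_apply_apply, levelMeasure_singleton_eq_mul hl.out x,
        levelRatio_eq_one hl.out hx, ENNReal.coe_one, one_mul])
  have h1 : ((levelMeasure l p).map (finRotate p)).real
      ((S.map (finRotate p).toEmbedding : Finset (Fin p)) : Set (Fin p)) ≤ 2 / (l * p) := by
    rw [measureReal_def, Measure.map_apply (measurable_of_countable _)
      (Set.toFinite _).measurableSet, Finset.coe_map, Equiv.coe_toEmbedding,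
      Set.preimage_image_eq _ (finRotate p).injective, ← measureReal_def]
    exact hbound S hS
  have h2 := hbound (S.map (finRotate p).toEmbedding) (by rwa [Finset.card_map])
  linarith

end Growth

/-! ### Existence of fast subsequences -/

section Existence

variable {l : ℝ≥0} {p : ℕ → ℕ}

lemma hellingerSq_nonneg {Y : Type*} [MeasurableSpace Y] (γ δ : Measure Y) :
    0 ≤ hellingerSq γ δ :=
  mul_nonneg (by norm_num) (integral_nonneg fun _ => sq_nonneg _)

lemma card_compl_setY_le [∀ n, NeZero (p n)] (n : ℕ) :
    ((setY p n)ᶜ.toFinite.toFinset).card ≤ 2 * partialProd p n + 1 := by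
  set P := partialProd p n with hP
  refine (Finset.card_le_card_of_injOn (fun x : Fin (p n) => (x : ℕ))
    -- The complement of `Y_n` lies in the last stretches of the two levels, with at most `P + 1`
    -- and `P` points.
    (t := Finset.Icc (p n / 2 - P) (p n / 2) ∪ Finset.Ico (p n - P) (p n))
    (fun x hx => ?_) (fun x _ y _ h => Fin.ext h)).trans ((Finset.card_union_le _ _).trans ?_)
  · simp only [Set.Finite.coe_toFinset, setY, Set.mem_compl_iff, Set.mem_union,
      Set.mem_ofPred_eq, not_or, not_and, not_lt] at hx
    obtain ⟨h1, h2⟩ := hx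
    have hxp := x.isLt
    have h1' : p n ≤ 2 * ((x : ℕ) + P) := by
      have : (p n : ℝ) ≤ 2 * ((x : ℕ) + P) := by linarith
      exact_mod_cast this
    have h2' : p n < 2 * (x : ℕ) → p n ≤ x + P := by
      intro h
      have h3 : (p n : ℝ) < 2 * (x : ℕ) := by exact_mod_cast h
      have h4 := h2 (by linarith)
      have : (p n : ℝ) ≤ (x : ℕ) + P := by linarith
      exact_mod_cast this
    simp only [Finset.coe_union, Finset.coe_Icc, Finset.coe_Ico, Set.mem_union, Set.mem_Icc,
      Set.mem_Ico]
    by_cases h : p n < 2 * (x : ℕ)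
    · have := h2' h
      omega
    · omega
  · rw [Nat.card_Icc, Nat.card_Ico]
    omega

lemma le_card_setZ (n : ℕ) :
    (p n + 1) / 2 - (partialProd p n + 1) ≤ ((setZ p n).toFinite.toFinset).card := by
  set P := partialProd p n with hP
  rw [← Nat.card_Ico]
  refine (Finset.card_le_card (t := (setZ p n).toFinite.toFinset.image fun x : Fin (p n) => (x : ℕ))
    fun m hm => ?_).trans Finset.card_image_le
  obtain ⟨h1, h2⟩ := Finset.mem_Ico.1 hm
  refine Finset.mem_image.2 ⟨⟨m, by omega⟩, ?_, rfl⟩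
  rw [Set.Finite.mem_toFinset]
  refine ⟨?_, ?_⟩
  · change ((P : ℕ) : ℝ) < (m : ℕ)
    exact_mod_cast h1
  · change ((m : ℕ) : ℝ) < (p n : ℝ) / 2
    have : ((2 * m : ℕ) : ℝ) < (p n : ℝ) := by exact_mod_cast (by omega : 2 * m < p n)
    push_cast at this
    linarith

/-- Rapid growth implies fastness. -/
lemma isFast_of_growth (hl : 0 < l) (hl1 : l < 1) (hpos : ∀ n, 0 < p n)
    (h : ∀ n, (2 : ℝ) ^ (n + 2) * (2 * partialProd p n + 1) / l < p n) : IsFast l p := by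
  have : ∀ n, NeZero (p n) := fun n => ⟨(hpos n).ne'⟩
  have : Fact (0 < l) := ⟨hl⟩
  have hl0 : (0 : ℝ) < l := by exact_mod_cast hl
  have hl1' : (l : ℝ) < 1 := by exact_mod_cast hl1
  have hp0 : ∀ n, (0 : ℝ) < p n := fun n => by exact_mod_cast hpos n
  have hP : ∀ n, (1 : ℝ) ≤ partialProd p n := fun n => by
    exact_mod_cast Finset.prod_pos (f := p) fun n _ => hpos n
  have h' : ∀ n, (2 : ℝ) ^ (n + 2) * (2 * partialProd p n + 1) < l * p n := fun n => by
    have := (div_lt_iff₀ hl0).1 (h n)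
    linarith
  refine ⟨?_, fun n => ?_, fun n => ?_⟩
  · refine Summable.of_nonneg_of_le (fun n => hellingerSq_nonneg _ _)
      (fun n => (hellingerSq_levelMeasure_le hl1).trans (?_ : _ ≤ (1 / 2 : ℝ) ^ n))
      summable_geometric_two
    rw [div_le_iff₀ (mul_pos hl0 (hp0 n)), one_div, inv_pow, inv_mul_eq_div,
      le_div_iff₀ (by positivity)]
    have h1 : (0 : ℝ) < 2 ^ n := by positivity
    have h2 := h' n
    have h3 := hP n
    rw [pow_add] at h2
    nlinarith
  · have hS := levelMeasure_real_coe_le hl1 (l := l) (setY p n)ᶜ.toFinite.toFinset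
    rw [Set.Finite.coe_toFinset, probReal_compl_eq_one_sub (Set.toFinite _).measurableSet] at hS
    have hcard : (((setY p n)ᶜ.toFinite.toFinset).card : ℝ) ≤ 2 * partialProd p n + 1 := by
      exact_mod_cast card_compl_setY_le n
    have hlt : (((setY p n)ᶜ.toFinite.toFinset).card : ℝ) / (l * p n) < (1 / 2) ^ (n + 2) := by
      rw [div_lt_iff₀ (mul_pos hl0 (hp0 n)), one_div, inv_pow, inv_mul_eq_div,
        lt_div_iff₀ (by positivity)]
      calc _ ≤ (2 * (partialProd p n : ℝ) + 1) * 2 ^ (n + 2) := by gcongr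
        _ = 2 ^ (n + 2) * (2 * (partialProd p n : ℝ) + 1) := mul_comm _ _
        _ < _ := h' n
    linarith
  · have hW := sum_levelWeight_le (p := p n) hl1
    have hW0 := sum_levelWeight_pos (p := p n) hl
    have hcard : ((p n : ℝ) / 2 - partialProd p n - 1) ≤ ((setZ p n).toFinite.toFinset).card := by
      have h1 := le_card_setZ (p := p) n
      have h2 : p n ≤ 2 * (((setZ p n).toFinite.toFinset).card + partialProd p n + 1) := by omega
      have h3 : (p n : ℝ) ≤
          2 * (((setZ p n).toFinite.toFinset).card + partialProd p n + 1) := by exact_mod_cast h2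
      linarith
    have hsum : ∑ x ∈ (setZ p n).toFinite.toFinset, levelWeight l (p n) x =
        ((setZ p n).toFinite.toFinset).card := by
      rw [Finset.sum_congr rfl (g := fun _ => (1 : ℝ)) fun x hx => ?_]
      · simp
      · have hx : x ∈ setZ p n := by simpa using hx
        exact if_pos (le_of_lt hx.2)
    have hreal := levelMeasure_real_coe (l := l) (setZ p n).toFinite.toFinset
    rw [Set.Finite.coe_toFinset, hsum] at hreal
    rw [hreal, div_lt_div_iff₀ (by positivity) hW0, one_mul]
    refine hW.trans_lt ?_
    -- This is the growth hypothesis with `2^n ≥ 1` and `l < 1`; it gives `p/2 - 2P - 2 > 2P ≥ 2`,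
    -- which absorbs the `+ 1` in the bound on the total weight.
    have h4 : 8 * (partialProd p n : ℝ) + 4 < p n := by
      have h5 := h' n
      have h6 : (1 : ℝ) ≤ 2 ^ n := one_le_pow₀ (by norm_num)
      have h7 : (l : ℝ) * p n < p n := by nlinarith [hp0 n]
      rw [pow_add] at h5
      nlinarith [hP n]
    have h8 := hP n
    nlinarith

theorem exists_isFast_subsequence (hl : 0 < l) (hl1 : l < 1) {q : ℕ → ℕ} (hq : IsCoprimeSeq q) :
    ∃ φ : ℕ → ℕ, StrictMono φ ∧ IsFast l fun n => q (φ n) := by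
  have hl0 : (0 : ℝ) < l := by exact_mod_cast hl
  set F : ℕ → ℕ → ℝ := fun n P => (2 : ℝ) ^ (n + 2) * (2 * P + 1) / l with hF
  have hFmono : ∀ {n n' P P' : ℕ}, n ≤ n' → P ≤ P' → F n P ≤ F n' P' := by
    intro n n' P P' hn hP
    have : (P : ℝ) ≤ P' := by exact_mod_cast hP
    simp only [hF]
    gcongr
    norm_num
  have hbig : ∀ (m : ℕ) (r : ℝ), ∃ m', m < m' ∧ r < q m' := by
    intro m r
    obtain ⟨N, hN⟩ := exists_nat_gt r
    refine ⟨max N (m + 1), by omega, hN.trans_le ?_⟩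
    exact_mod_cast (le_max_left N (m + 1)).trans hq.strictMono.le_apply
  -- The next term is chosen against the product of all `q i` with `i ≤ m`. This bounds the product
  -- over the terms already selected, so the recursion needs to remember only the last index.
  choose g hg hgF using fun m => hbig m (F (m + 1) (partialProd q (m + 1)))
  obtain ⟨m₀, -, hm₀⟩ := hbig 0 (F 0 1)
  set φ : ℕ → ℕ := fun n => Nat.rec m₀ (fun _ m => g m) n
  have hφ : StrictMono φ := strictMono_nat_of_lt_succ fun n => hg (φ n)
  refine ⟨φ, hφ, isFast_of_growth hl hl1 (fun n => hq.pos _) fun n => ?_⟩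
  cases n with
  | zero =>
    rw [partialProd, Finset.prod_range_zero]
    exact hm₀
  | succ n =>
    refine lt_of_le_of_lt (hFmono (Nat.succ_le_succ (hφ.le_apply (x := n))) ?_) (hgF (φ n))
    rw [partialProd, partialProd, ← Finset.prod_image (f := q) hφ.injective.injOn]
    refine Finset.prod_le_prod_of_subset_of_one_le' (fun m hm => ?_) fun m _ _ => hq.pos m
    obtain ⟨i, hi, rfl⟩ := Finset.mem_image.1 hm
    exact Finset.mem_range.2 (Nat.lt_succ_of_le
      (hφ.monotone (Nat.lt_succ_iff.1 (Finset.mem_range.1 hi))))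

end Existence

end RigidIDPFT

end

theorem proposition2p12 (lam : ℝ) (hlam0 : 0 < lam) (hlam1 : lam < 1) :
    (∀ q : ℕ → ℕ, RigidIDPFT.IsCoprimeSeq q →
      ∃ φ : ℕ → ℕ, StrictMono φ ∧ RigidIDPFT.IsFast lam fun n => q (φ n)) ∧
    (∀ p : ℕ → ℕ, RigidIDPFT.IsCoprimeSeq p → RigidIDPFT.IsFast lam p →
      RigidIDPFT.IsIDPFT (fun n => RigidIDPFT.levelMeasure lam (p n))
        (fun n => finRotate (p n)) ∧
      RigidIDPFT.IsRigid (RigidIDPFT.prodMeasure lam p) (RigidIDPFT.prodRotation p) ∧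
      RigidIDPFT.IsKriegerTypeIII lam (RigidIDPFT.prodMeasure lam p)
        (Subgroup.zpowers (RigidIDPFT.prodRotation p))) := by
  lift lam to NNReal using hlam0.le
  have hl : 0 < lam := by exact_mod_cast hlam0
  have hl1 : lam < 1 := by exact_mod_cast hlam1
  have : Fact (0 < lam) := ⟨hl⟩
  refine ⟨fun q hq => RigidIDPFT.exists_isFast_subsequence hl hl1 hq, fun p hp hf => ?_⟩
  have : ∀ n, NeZero (p n) := fun n => ⟨(hp.pos n).ne'⟩
  refine ⟨⟨fun n => inferInstance, fun n => RigidIDPFT.isFiniteType_levelMeasure hl (p n), ?_⟩,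
    RigidIDPFT.isRigid_prodRotation hf hp, RigidIDPFT.isKriegerTypeIII_prodRotation hf hp hl1⟩
  have := RigidIDPFT.isNonsingular_prodRotation_pow hf hp 1
  rwa [pow_one] at this
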